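/- Let $p:\mathbb{R}\to\mathbb{R}$ be continuous and periodic with period $P>0$, and let $q:[0,\infty)\to\mathbb{R}$ be locally integrable on $[0,\infty)$ with $\frac1x\int_0^x|q(t)|\,dt\to 0$ as $x\to\infty$. For a real locally integrable potential $V$ and a Dirichlet ($\phi(0)=0$) or Neumann ($\phi'(0)=0$) boundary condition, let $-\frac{d^2}{dx^2}+V$ denote the half-line Schrödinger operator in $L^2(0,\infty)$ on its maximal domain (those $\phi\in L^2$ with $\phi,\phi'$ locally absolutely continuous on $[0,\infty)$, $-\phi''+V\phi\in L^2$, and the boundary condition at $0$). Let $A=-\frac{d^2}{dx^2}+p+q$ with one of these two boundary conditions, and assume that $q$ is non-destructive, i.e. that $\mathfrak{e}:=\sigma_{\mathrm{ess}}(A)$ equals $\sigma_{\mathrm{ess}}\left(-\frac{d^2}{dx^2}+p\right)$ (the latter operator with either boundary condition). For $\xi\in\mathbb{R}$ let $u(\xi,\cdot)$ be the solution on $[0,\infty)$ of $-u''+(p+q)u=\xi u$ satisfying the boundary condition of $A$ with standard normalization: $u(\xi,0)=1,\ u'(\xi,0)=0$ in the Neumann case, $u(\xi,0)=0,\ u'(\xi,0)=1$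 in the Dirichlet case. Then $A$ satisfies regularity bounds: for every $\epsilon>0$ there exist $\delta_1>0$ and a constant $C$ such that $$\int_0^L u(\xi,x)^2\,dx\le C e^{\epsilon L}\qquad\text{for all } L\ge 0 \text{ and all } \xi\in\mathbb{R} \text{ with } \operatorname{dist}(\xi,\mathfrak{e})\le\delta_1 .$$ -/

import Mathlib

open Set Filter Topology MeasureTheory

namespace HalfLine

/-- The Hilbert space `L²(0, ∞)` of complex-valued functions. -/
abbrev L2 : Type := Lp ℂ 2 (volume.restrict (Ioi (0 : ℝ)))

/-- `φ` is continuously differentiable on `[0, ∞)` with derivative `φ'` (one-sided at `0`), the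
function `φ'` is locally absolutely continuous on `[0, ∞)`, and `φ'' = g` almost everywhere. The
last two conditions are written in integrated form. -/
structure HasSecondDeriv {E : Type*} [NormedAddCommGroup E] [NormedSpace ℝ E]
    (φ φ' g : ℝ → E) : Prop where
  hasDeriv : ∀ x, 0 ≤ x → HasDerivWithinAt φ (φ' x) (Ici 0) x
  integrable : ∀ x, 0 ≤ x → IntervalIntegrable g volume 0 x
  deriv_eq : ∀ x, 0 ≤ x → φ' x = φ' 0 + ∫ t in (0 : ℝ)..x, g t

theorem HasSecondDeriv.add {E : Type*} [NormedAddCommGroup E] [NormedSpace ℝ E]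
    {φ φ' g ψ ψ' h : ℝ → E} (h₁ : HasSecondDeriv φ φ' g) (h₂ : HasSecondDeriv ψ ψ' h) :
    HasSecondDeriv (fun x => φ x + ψ x) (fun x => φ' x + ψ' x) (fun x => g x + h x) where
  hasDeriv x hx := (h₁.hasDeriv x hx).add (h₂.hasDeriv x hx)
  integrable x hx := (h₁.integrable x hx).add (h₂.integrable x hx)
  deriv_eq x hx := by
    rw [intervalIntegral.integral_add (h₁.integrable x hx) (h₂.integrable x hx),
      h₁.deriv_eq x hx, h₂.deriv_eq x hx]
    abel

theorem HasSecondDeriv.const_mul {φ φ' g : ℝ → ℂ} (h : HasSecondDeriv φ φ' g) (c : ℂ) :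
    HasSecondDeriv (fun x => c * φ x) (fun x => c * φ' x) (fun x => c * g x) where
  hasDeriv x hx := (h.hasDeriv x hx).const_mul c
  integrable x hx := (h.integrable x hx).const_mul c
  deriv_eq x hx := by
    rw [intervalIntegral.integral_const_mul, h.deriv_eq x hx]
    ring

/-- The two boundary conditions at `x = 0`. -/
inductive BoundaryCondition where
  | dirichlet
  | neumann

/-- The boundary condition for a function with value `a` and derivative `b` at `0`:
`a = 0` (Dirichlet) or `b = 0` (Neumann). -/
def BoundaryCondition.Holds : BoundaryCondition → ℂ → ℂ → Prop
  | .dirichlet, a, _ => a = 0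
  | .neumann, _, b => b = 0

theorem BoundaryCondition.Holds.add {bc : BoundaryCondition} {a b a' b' : ℂ}
    (h : bc.Holds a b) (h' : bc.Holds a' b') : bc.Holds (a + a') (b + b') := by
  cases bc <;> simp_all [BoundaryCondition.Holds]

theorem BoundaryCondition.Holds.const_mul {bc : BoundaryCondition} {a b : ℂ}
    (h : bc.Holds a b) (c : ℂ) : bc.Holds (c * a) (c * b) := by
  cases bc <;> simp_all [BoundaryCondition.Holds]

/-- The graph of `-d²/dx² + V` on its maximal domain in `L²(0, ∞)` with the given boundary
condition: all pairs `(f, k)` in `L² × L²` such that `f` is represented by a function `φ` with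
`φ, φ'` locally absolutely continuous on `[0, ∞)` that satisfies the boundary condition, and
`k = -φ'' + V φ` almost everywhere. -/
def schrodingerGraph (V : ℝ → ℝ) (bc : BoundaryCondition) : Submodule ℂ (L2 × L2) where
  carrier := {z | ∃ φ φ' g : ℝ → ℂ, HasSecondDeriv φ φ' g ∧ bc.Holds (φ 0) (φ' 0) ∧
    (z.1 =ᵐ[volume.restrict (Ioi 0)] φ) ∧
    (z.2 =ᵐ[volume.restrict (Ioi 0)] fun x => -g x + (V x : ℂ) * φ x)}
  zero_mem' := by
    refine ⟨fun _ => 0, fun _ => 0, fun _ => 0, ⟨?_, ?_, ?_⟩, ?_, ?_, ?_⟩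
    · intro x _
      exact hasDerivWithinAt_const x _ (0 : ℂ)
    · intro x _
      exact intervalIntegrable_const
    · intro x _
      simp
    · cases bc <;> simp [BoundaryCondition.Holds]
    · exact Lp.coeFn_zero ℂ 2 _
    · filter_upwards [Lp.coeFn_zero ℂ 2 (volume.restrict (Ioi (0 : ℝ)))] with x hx
      simpa using hx
  add_mem' := by
    rintro ⟨f₁, k₁⟩ ⟨f₂, k₂⟩ ⟨φ, φ', g, h, hb, hf, hk⟩ ⟨ψ, ψ', g₂, h₂, hb₂, hf₂, hk₂⟩
    refine ⟨_, _, _, h.add h₂, hb.add hb₂, ?_, ?_⟩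
    · filter_upwards [Lp.coeFn_add f₁ f₂, hf, hf₂] with x hx h1 h2
      simp only [Prod.mk_add_mk, hx, Pi.add_apply] at *
      rw [h1, h2]
    · filter_upwards [Lp.coeFn_add k₁ k₂, hk, hk₂] with x hx h1 h2
      simp only [Prod.mk_add_mk, hx, Pi.add_apply] at *
      rw [h1, h2]
      ring
  smul_mem' := by
    rintro c ⟨f, k⟩ ⟨φ, φ', g, h, hb, hf, hk⟩
    refine ⟨_, _, _, h.const_mul c, hb.const_mul c, ?_, ?_⟩
    · filter_upwards [Lp.coeFn_smul c f, hf] with x hx h1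
      simp only [Prod.smul_mk, hx, Pi.smul_apply, smul_eq_mul] at *
      rw [h1]
    · filter_upwards [Lp.coeFn_smul c k, hk] with x hx h1
      simp only [Prod.smul_mk, hx, Pi.smul_apply, smul_eq_mul] at *
      rw [h1]
      ring

/-- The graph is single-valued, so it is the graph of an operator. -/
theorem schrodingerGraph_single_valued (V : ℝ → ℝ) (bc : BoundaryCondition)
    (z : L2 × L2) (hz : z ∈ schrodingerGraph V bc) (hz0 : z.1 = 0) : z.2 = 0 := by
  obtain ⟨φ, φ', g, h, -, hf, hk⟩ := hz
  have hφc : ContinuousOn φ (Ici 0) := fun x hx => (h.hasDeriv x hx).continuousWithinAt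
  have hφae : φ =ᵐ[volume.restrict (Ioi 0)] fun _ => (0 : ℂ) := by
    rw [hz0] at hf
    exact hf.symm.trans (Lp.coeFn_zero ℂ 2 _)
  have hφ0 : EqOn φ (fun _ => (0 : ℂ)) (Ioi 0) :=
    Measure.eqOn_open_of_ae_eq hφae isOpen_Ioi (hφc.mono Ioi_subset_Ici_self) continuousOn_const
  have hφ'0 : ∀ x, 0 < x → φ' x = 0 := by
    intro x hx
    have h1 : HasDerivAt φ (φ' x) x := (h.hasDeriv x hx.le).hasDerivAt (Ici_mem_nhds hx)
    have h2 : HasDerivAt φ 0 x :=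
      (hasDerivAt_const x (0 : ℂ)).congr_of_eventuallyEq
        (hφ0.eventuallyEq_of_mem (Ioi_mem_nhds hx))
    exact h1.unique h2
  have hint : ∀ x, 0 < x → ∫ t in (0 : ℝ)..x, g t = -φ' 0 := by
    intro x hx
    have := h.deriv_eq x hx.le
    rw [hφ'0 x hx] at this
    exact (neg_eq_of_add_eq_zero_right this.symm).symm
  have hg : g =ᵐ[volume.restrict (Ioi 0)] fun _ => (0 : ℂ) := by
    have key : ∀ n : ℕ, ∀ᵐ x, x ∈ Ioo (0 : ℝ) n → g x = 0 := by
      intro n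
      have hi := h.integrable n n.cast_nonneg
      filter_upwards [hi.ae_hasDerivAt_integral] with x hx hxn
      have hx0 : x ∈ uIcc (0 : ℝ) n := by
        rw [uIcc_of_le n.cast_nonneg]
        exact Ioo_subset_Icc_self hxn
      have h1 := hx hx0 0 (by simp)
      have h2 : HasDerivAt (fun y => ∫ t in (0 : ℝ)..y, g t) 0 x :=
        (hasDerivAt_const x (-φ' 0)).congr_of_eventuallyEq (by
          filter_upwards [Ioi_mem_nhds hxn.1] with y hy using hint y hy)
      exact h1.unique h2
    rw [EventuallyEq, ae_restrict_iff' measurableSet_Ioi]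
    filter_upwards [ae_all_iff.2 key] with x hx hx0
    obtain ⟨n, hn⟩ := exists_nat_gt x
    exact hx n ⟨hx0, hn⟩
  refine (Lp.eq_zero_iff_ae_eq_zero).2 ?_
  filter_upwards [hk, hg, hφae] with x h1 h2 h3
  rw [h1, h2, h3]
  simp

/-- The half-line Schrödinger operator `-d²/dx² + V` in `L²(0, ∞)` with the given boundary
condition at `0`, as a partially defined linear operator. -/
noncomputable def schrodinger (V : ℝ → ℝ) (bc : BoundaryCondition) : L2 →ₗ.[ℂ] L2 :=
  (schrodingerGraph V bc).toLinearPMap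

theorem schrodinger_graph (V : ℝ → ℝ) (bc : BoundaryCondition) :
    (schrodinger V bc).graph = schrodingerGraph V bc :=
  Submodule.toLinearPMap_graph_eq _ (schrodingerGraph_single_valued V bc)

/-- The (real) essential spectrum of an unbounded operator `T`: all real `ξ` for which `T - ξ` is
not a Fredholm operator, Fredholm meaning finite-dimensional kernel and closed range of finite
codimension. -/
def essentialSpectrum {H : Type*} [NormedAddCommGroup H] [NormedSpace ℂ H] (T : H →ₗ.[ℂ] H) :
    Set ℝ :=
  {ξ | ¬ (FiniteDimensional ℂ (LinearMap.ker (T.toFun - (ξ : ℂ) • T.domain.subtype)) ∧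
    IsClosed (LinearMap.range (T.toFun - (ξ : ℂ) • T.domain.subtype) : Set H) ∧
    FiniteDimensional ℂ (H ⧸ LinearMap.range (T.toFun - (ξ : ℂ) • T.domain.subtype)))}

/-- `φ` is a (real) solution on `[0, ∞)` of `-φ'' + V φ = ξ φ`, with derivative `φ'`. -/
def IsSolution (V : ℝ → ℝ) (ξ : ℝ) (φ φ' : ℝ → ℝ) : Prop :=
  HasSecondDeriv φ φ' (fun x => (V x - ξ) * φ x)

/-- The initial values at `0` of the fundamental solution that satisfies the boundary condition:
`φ(0) = 0, φ'(0) = 1` (Dirichlet) or `φ(0) = 1, φ'(0) = 0` (Neumann). -/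
def BoundaryCondition.Normalized : BoundaryCondition → ℝ → ℝ → Prop
  | .dirichlet, a, b => a = 0 ∧ b = 1
  | .neumann, a, b => a = 1 ∧ b = 0

/-- Regularity bounds for the half-line Schrödinger operator with potential `V` and the given
boundary condition. `Metric.cthickening δ₁ S` is the set of points at distance at most `δ₁`
from `S`. -/
def RegularityBounds (V : ℝ → ℝ) (bc : BoundaryCondition) : Prop :=
  ∀ ε : ℝ, 0 < ε → ∃ δ₁ : ℝ, 0 < δ₁ ∧ ∃ C : ℝ,
    ∀ ξ ∈ Metric.cthickening δ₁ (essentialSpectrum (schrodinger V bc)),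
      ∀ u u' : ℝ → ℝ, IsSolution V ξ u u' → bc.Normalized (u 0) (u' 0) →
        ∀ L : ℝ, 0 ≤ L → ∫ x in (0 : ℝ)..L, u x ^ 2 ≤ C * Real.exp (ε * L)

end HalfLine

/-! The hypothesis on the essential spectrum replaces `𝔢` by the essential spectrum of the periodic
operator, and from there everything is Floquet theory plus Grönwall.

Let `D(ξ)` be the discriminant of the periodic equation. If `|D(ξ)| > 2`, one Floquet solution
decays and one grows. The Green function built from them inverts the equation in L² on the
orthogonal complement of the decaying solution, so `T - ξ` is Fredholm. Hence `|D| ≤ 2` on `𝔢`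
(`abs_discriminant_le_two`). Since `D` is Lipschitz in `ξ` on bounded energy ranges
(`IsDiscriminant.abs_sub_le`), `|D(ξ)| ≤ e^κ + e^{-κ}` for `ξ` close to `𝔢`. The monodromy matrix
then has eigenvalues of modulus at most `e^κ`, and periodic solutions grow at an exponential rate
proportional to `κ`, uniformly in `ξ` (`IsDiscriminant.backward_bound`).

The perturbation enters through Lagrange's identity with the periodic solution `w` having `w(x) =
0`, `w'(x) = -1`: it expresses `u(x)` by initial data and `∫ w q u`. Grönwall bounds `u(x)` by the
periodic growth times `exp(2A ∫|q|)` (`IsSolution.abs_le`), and `∫_0^x |q| ≤ C + ηx` with `η` as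
small as desired.

Uniformity in `ξ` needs bounded energies. From below, `D > 2` under the minimum of `p`
(`IsDiscriminant.two_lt`). For large `ξ`, all of `p + q` is treated as a perturbation of the free
equation, whose kernel `sin(k(x-t))/k` is small (`IsSolution.abs_le_high_energy`). -/

namespace HalfLine

/-! ### Linear equations with bounded continuous coefficients. -/

/-- The Picard iterates of the linear equation `y' = A y` with initial value `v` at `t₀`; their sum
is the solution. -/
noncomputable def picardTerm {E : Type*} [NormedAddCommGroup E] [NormedSpace ℝ E]
    (A : ℝ → E →L[ℝ] E) (t₀ : ℝ) (v : E) : ℕ → ℝ → E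
  | 0 => fun _ => v
  | n + 1 => fun t => ∫ s in t₀..t, A s (picardTerm A t₀ v n s)

section Linear

variable {E : Type*} [NormedAddCommGroup E] [NormedSpace ℝ E]
  {A : ℝ → E →L[ℝ] E}

theorem continuous_picardTerm (hA : Continuous A) (t₀ : ℝ) (v : E) (n : ℕ) :
    Continuous (picardTerm A t₀ v n) := by
  induction n with
  | zero => exact continuous_const
  | succ n ih =>
    exact intervalIntegral.continuous_primitive
      (fun a b => (hA.clm_apply ih).intervalIntegrable a b) t₀

theorem hasDerivAt_picardTerm_succ [CompleteSpace E] (hA : Continuous A) (t₀ : ℝ) (v : E) (n : ℕ)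
    (t : ℝ) :
    HasDerivAt (picardTerm A t₀ v (n + 1)) (A t (picardTerm A t₀ v n t)) t := by
  have h := hA.clm_apply (continuous_picardTerm hA t₀ v n)
  exact intervalIntegral.integral_hasDerivAt_right (h.intervalIntegrable _ _)
    (h.stronglyMeasurableAtFilter _ _) h.continuousAt

theorem norm_picardTerm_le {K : ℝ} (hK : ∀ t, ‖A t‖ ≤ K) (t₀ : ℝ) (v : E) (n : ℕ)
    (t : ℝ) :
    ‖picardTerm A t₀ v n t‖ ≤ ‖v‖ * (K * |t - t₀|) ^ n / n.factorial := by
  have hK0 : 0 ≤ K := (norm_nonneg _).trans (hK 0)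
  induction n generalizing t with
  | zero => simp [picardTerm]
  | succ n ih =>
    rw [picardTerm, intervalIntegral.norm_intervalIntegral_eq]
    have hb : ∀ s, ‖A s (picardTerm A t₀ v n s)‖ ≤
        K * ‖v‖ * K ^ n / n.factorial * |s - t₀| ^ n := fun s =>
      calc ‖A s (picardTerm A t₀ v n s)‖ ≤ K * (‖v‖ * (K * |s - t₀|) ^ n / n.factorial) :=
            (A s).le_of_opNorm_le_of_le (hK s) (ih s)
        _ = _ := by rw [mul_pow]; ring
    refine (norm_integral_le_of_norm_le (Continuous.integrableOn_uIoc (by fun_prop))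
      (Eventually.of_forall hb)).trans (le_of_eq ?_)
    rw [integral_const_mul, integral_pow_abs_sub_uIoc, Nat.factorial_succ]
    push_cast
    field_simp
    ring

/-- The derivative of each Picard term is `A` applied to the preceding one, so both the series and
its termwise derivative have an exponential series as majorant on every ball. The global bound on
`A` gives a solution on the whole line. -/
theorem exists_linear_ode_solution [CompleteSpace E] (hA : Continuous A) {K : ℝ}
    (hK : ∀ t, ‖A t‖ ≤ K) (t₀ : ℝ) (v : E) :
    ∃ y : ℝ → E, y t₀ = v ∧ ∀ t, HasDerivAt y (A t (y t)) t := by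
  have hK0 : 0 ≤ K := (norm_nonneg _).trans (hK 0)
  have hsum : ∀ t, Summable fun n => picardTerm A t₀ v n t := fun t => by
    refine Summable.of_norm_bounded (g := fun n : ℕ => ‖v‖ * ((K * |t - t₀|) ^ n / n.factorial))
      ((Real.summable_pow_div_factorial _).mul_left _) fun n => ?_
    rw [← mul_div_assoc]
    exact norm_picardTerm_le hK t₀ v n t
  have hzero : ∀ n, picardTerm A t₀ v (n + 1) t₀ = 0 := fun n => by simp [picardTerm]
  refine ⟨fun t => ∑' n, picardTerm A t₀ v n t, ?_, fun t => ?_⟩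
  · beta_reduce
    rw [(hsum t₀).tsum_eq_zero_add]
    simp [picardTerm]
  · have hd := hasDerivAt_tsum_of_isPreconnected
      (u := fun n : ℕ => K * (‖v‖ * ((K * (|t - t₀| + 1)) ^ n / n.factorial)))
      (g := fun n => picardTerm A t₀ v (n + 1))
      (g' := fun n s => A s (picardTerm A t₀ v n s)) (t := Metric.ball t₀ (|t - t₀| + 1))
      (y₀ := t₀) (y := t)
      (((Real.summable_pow_div_factorial _).mul_left _).mul_left _)
      Metric.isOpen_ball (convex_ball _ _).isPreconnected
      (fun n s _ => hasDerivAt_picardTerm_succ hA t₀ v n s)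
      (fun n s hs => by
        refine (A s).le_of_opNorm_le_of_le (hK s) ((norm_picardTerm_le hK t₀ v n s).trans ?_)
        rw [mul_div_assoc]
        have : |s - t₀| ≤ |t - t₀| + 1 := by
          rw [Metric.mem_ball, Real.dist_eq] at hs; exact hs.le
        gcongr)
      (Metric.mem_ball_self (by positivity))
      (by simp [hzero, summable_zero])
      (by rw [Metric.mem_ball, Real.dist_eq]; linarith)
    have h2 : (fun t => ∑' n, picardTerm A t₀ v n t) =
        fun t => v + ∑' n, picardTerm A t₀ v (n + 1) t := by
      funext s
      rw [(hsum s).tsum_eq_zero_add]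
      rfl
    rw [← (A t).map_tsum (hsum t)] at hd
    exact (hd.const_add v).congr_of_eventuallyEq (Eventually.of_forall fun s => congrFun h2 s)

end Linear

/-! ### Solutions of `u'' = V u`: existence, symmetries, growth and uniqueness. -/

/-- `u` is a solution of `u'' = V u` on the whole line, with derivative `u'`. -/
structure IsGlobalSolution (V u u' : ℝ → ℝ) : Prop where
  hasDerivAt : ∀ x, HasDerivAt u (u' x) x
  hasDerivAt' : ∀ x, HasDerivAt u' (V x * u x) x

theorem exists_globalSolution {V : ℝ → ℝ} (hV : Continuous V) {K : ℝ} (hK : ∀ x, |V x| ≤ K)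
    (t₀ a b : ℝ) : ∃ u u', IsGlobalSolution V u u' ∧ u t₀ = a ∧ u' t₀ = b := by
  let A : ℝ → (ℝ × ℝ) →L[ℝ] (ℝ × ℝ) := fun t =>
    (ContinuousLinearMap.snd ℝ ℝ ℝ).prod (V t • ContinuousLinearMap.fst ℝ ℝ ℝ)
  have hAc : Continuous A := by
    have : A = fun t => (ContinuousLinearMap.snd ℝ ℝ ℝ).prod 0 +
        V t • (ContinuousLinearMap.prod 0 (ContinuousLinearMap.fst ℝ ℝ ℝ)) := by
      funext t
      ext <;> simp [A]
    rw [this]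
    fun_prop
  have hAn : ∀ t, ‖A t‖ ≤ max 1 K := fun t => by
    refine ContinuousLinearMap.opNorm_le_bound _ (by positivity) fun y => ?_
    simp only [A, ContinuousLinearMap.prod_apply, Prod.norm_def]
    refine max_le ?_ ?_
    · refine (le_max_right ‖y.1‖ ‖y.2‖).trans (le_mul_of_one_le_left ?_ (le_max_left _ _))
      positivity
    · simp only [_root_.smul_apply, ContinuousLinearMap.coe_fst', norm_smul]
      exact mul_le_mul ((hK t).trans (le_max_right _ _)) (le_max_left _ _) (norm_nonneg _)
        (by positivity)
  obtain ⟨y, h0, hy⟩ := exists_linear_ode_solution hAc hAn t₀ (a, b)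
  refine ⟨fun t => (y t).1, fun t => (y t).2, ⟨fun x => ?_, fun x => ?_⟩, by simp [h0], by simp [h0]⟩
  · exact (hy x).fst
  · exact (hy x).snd

namespace IsGlobalSolution

variable {V u u' v v' : ℝ → ℝ}

theorem continuous (h : IsGlobalSolution V u u') : Continuous u :=
  continuous_iff_continuousAt.2 fun x => (h.hasDerivAt x).continuousAt

theorem continuous' (h : IsGlobalSolution V u u') : Continuous u' :=
  continuous_iff_continuousAt.2 fun x => (h.hasDerivAt' x).continuousAt

theorem linear_comb (h : IsGlobalSolution V u u') (h₂ : IsGlobalSolution V v v') (a b : ℝ) :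
    IsGlobalSolution V (fun x => a * u x + b * v x) (fun x => a * u' x + b * v' x) where
  hasDerivAt x := ((h.hasDerivAt x).const_mul a).add ((h₂.hasDerivAt x).const_mul b)
  hasDerivAt' x := (((h.hasDerivAt' x).const_mul a).add ((h₂.hasDerivAt' x).const_mul b)).congr_deriv
    (by ring)

theorem shift (h : IsGlobalSolution V u u') (a : ℝ) :
    IsGlobalSolution (fun x => V (x + a)) (fun x => u (x + a)) (fun x => u' (x + a)) where
  hasDerivAt x := (h.hasDerivAt (x + a)).comp_add_const x a
  hasDerivAt' x := (h.hasDerivAt' (x + a)).comp_add_const x a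

theorem shift_periodic (h : IsGlobalSolution V u u') {P : ℝ} (hV : Function.Periodic V P) :
    IsGlobalSolution V (fun x => u (x + P)) (fun x => u' (x + P)) := by
  have := h.shift P
  rwa [show (fun x => V (x + P)) = V from funext hV] at this

theorem reflect (h : IsGlobalSolution V u u') (a : ℝ) :
    IsGlobalSolution (fun x => V (a - x)) (fun x => u (a - x)) (fun x => -u' (a - x)) where
  hasDerivAt x := (h.hasDerivAt (a - x)).comp_const_sub a x
  hasDerivAt' x := by
    exact ((h.hasDerivAt' (a - x)).comp_const_sub a x).fun_neg.congr_deriv (by ring)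

theorem wronskian_eq (h : IsGlobalSolution V u u') (h₂ : IsGlobalSolution V v v') (x : ℝ) :
    u x * v' x - u' x * v x = u 0 * v' 0 - u' 0 * v 0 := by
  have hd : ∀ x, HasDerivAt (fun x => u x * v' x - u' x * v x) 0 x := fun x =>
    (((h.hasDerivAt x).mul (h₂.hasDerivAt' x)).sub
      ((h.hasDerivAt' x).mul (h₂.hasDerivAt x))).congr_deriv (by ring)
  exact is_const_of_deriv_eq_zero (fun x => (hd x).differentiableAt) (fun x => (hd x).deriv) x 0

end IsGlobalSolution

/-- Growth bound for the forced equation `d'' = e` with `|e| ≤ K |d| + η`. -/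
theorem norm_le_gronwallBound_of_second_deriv {d d' e : ℝ → ℝ} {K η δ T : ℝ} (hK : 1 ≤ K)
    (hη : 0 ≤ η)
    (hd : ∀ x, HasDerivAt d (d' x) x) (hd' : ∀ x, HasDerivAt d' (e x) x)
    (he : ∀ x ∈ Icc 0 T, |e x| ≤ K * |d x| + η) (h0 : |d 0| ≤ δ) (h0' : |d' 0| ≤ δ) :
    ∀ x ∈ Icc 0 T, |d x| ≤ gronwallBound δ K η x ∧ |d' x| ≤ gronwallBound δ K η x := by
  have hy : ∀ x, HasDerivAt (fun x => (d x, d' x)) (d' x, e x) x := fun x => (hd x).prodMk (hd' x)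
  have hb := norm_le_gronwallBound_of_norm_deriv_right_le (f := fun x => (d x, d' x))
    (f' := fun x => (d' x, e x)) (δ := δ) (K := K) (ε := η) (a := 0) (b := T)
    (fun x _ => (hy x).continuousAt.continuousWithinAt) (fun x _ => (hy x).hasDerivWithinAt)
    (by simp only [Prod.norm_def]; exact max_le h0 h0')
    (fun x hx => by
      simp only [Prod.norm_def, Real.norm_eq_abs]
      refine max_le ?_ ?_
      -- The equation for the first component of `(d, d')` has coefficient 1; this is where `1 ≤ K`
      -- is needed.
      · have h1 : |d' x| ≤ max |d x| |d' x| := le_max_right _ _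
        have h2 : 0 ≤ max |d x| |d' x| := by positivity
        nlinarith
      · refine (he x ⟨hx.1, hx.2.le⟩).trans ?_
        gcongr
        exact le_max_left _ _)
  intro x hx
  have := hb x hx
  rw [sub_zero, Prod.norm_def] at this
  exact ⟨(le_max_left _ _).trans this, (le_max_right _ _).trans this⟩

namespace IsGlobalSolution

variable {V u u' v v' : ℝ → ℝ}

theorem bound_right (h : IsGlobalSolution V u u') {K δ : ℝ} (hK : 1 ≤ K) (hV : ∀ x, |V x| ≤ K)
    (h0 : |u 0| ≤ δ) (h0' : |u' 0| ≤ δ) {x : ℝ} (hx : 0 ≤ x) :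
    |u x| ≤ δ * Real.exp (K * x) ∧ |u' x| ≤ δ * Real.exp (K * x) := by
  have := norm_le_gronwallBound_of_second_deriv hK le_rfl h.hasDerivAt h.hasDerivAt' (T := x)
    (fun y _ => by
      rw [abs_mul, add_zero]
      exact mul_le_mul_of_nonneg_right (hV y) (abs_nonneg _)) h0 h0' x ⟨hx, le_rfl⟩
  rwa [gronwallBound_ε0] at this

theorem bound_left (h : IsGlobalSolution V u u') {K δ a : ℝ} (hK : 1 ≤ K) (hV : ∀ x, |V x| ≤ K)
    (h0 : |u a| ≤ δ) (h0' : |u' a| ≤ δ) {x : ℝ} (hx : x ≤ a) :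
    |u x| ≤ δ * Real.exp (K * (a - x)) ∧ |u' x| ≤ δ * Real.exp (K * (a - x)) := by
  have := (h.reflect a).bound_right hK (fun x => hV _) (δ := δ) (by simpa using h0)
    (by simpa using h0') (sub_nonneg.2 hx)
  simpa using this

theorem eq_zero (h : IsGlobalSolution V u u') {K : ℝ} (hV : ∀ x, |V x| ≤ K)
    (h0 : u 0 = 0) (h0' : u' 0 = 0) (x : ℝ) : u x = 0 ∧ u' x = 0 := by
  have hV' : ∀ x, |V x| ≤ max 1 K := fun x => (hV x).trans (le_max_right _ _)
  rcases le_total 0 x with hx | hx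
  · have := h.bound_right (le_max_left 1 K) hV' (δ := 0) (by simp [h0]) (by simp [h0']) hx
    simpa using this
  · have := h.bound_left (le_max_left 1 K) hV' (δ := 0) (a := 0) (by simp [h0]) (by simp [h0']) hx
    simpa using this

theorem eq_of_initial (h : IsGlobalSolution V u u') (h₂ : IsGlobalSolution V v v') {K : ℝ}
    (hV : ∀ x, |V x| ≤ K) (h0 : u 0 = v 0) (h0' : u' 0 = v' 0) (x : ℝ) :
    u x = v x ∧ u' x = v' x := by
  have := (h.linear_comb h₂ 1 (-1)).eq_zero hV (by simp [h0]) (by simp [h0']) x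
  constructor <;> linarith [this.1, this.2]

end IsGlobalSolution

/-! ### Locally absolutely continuous functions: product rule and Lagrange's identity. -/

section Primitive

variable {E : Type*} [NormedAddCommGroup E]

theorem intervalIntegrable_of_nonneg {g : ℝ → E}
    (hg : ∀ x, 0 ≤ x → IntervalIntegrable g volume 0 x) {a b : ℝ} (ha : 0 ≤ a) (hb : 0 ≤ b) :
    IntervalIntegrable g volume a b :=
  (hg a ha).symm.trans (hg b hb)

theorem intervalIntegrable_of_continuousOn_Ici {F : ℝ → E} (hF : ContinuousOn F (Ici 0)) {x : ℝ}
    (hx : 0 ≤ x) : IntervalIntegrable F volume 0 x :=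
  (hF.mono (by rw [uIcc_of_le hx]; exact Icc_subset_Ici_self)).intervalIntegrable

variable [NormedSpace ℝ E]

theorem continuousOn_primitive_Ici {g : ℝ → E}
    (hg : ∀ x, 0 ≤ x → IntervalIntegrable g volume 0 x) :
    ContinuousOn (fun x => ∫ t in (0 : ℝ)..x, g t) (Ici 0) := by
  intro x hx
  have hx0 : (0 : ℝ) ≤ x := hx
  have h := intervalIntegral.continuousOn_primitive_interval (a := 0) (b := x + 1) (f := g)
    (μ := volume) ((intervalIntegrable_iff' (by finiteness)).1 (hg (x + 1) (by linarith)))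
  rw [uIcc_of_le (by linarith)] at h
  refine (h x ⟨hx, by linarith⟩).mono_of_mem_nhdsWithin ?_
  exact mem_nhdsWithin.2 ⟨Iio (x + 1), isOpen_Iio, by simp, fun y hy => ⟨hy.2, (le_of_lt hy.1)⟩⟩

theorem continuousOn_Ici_of_primitive {F g : ℝ → E}
    (hg : ∀ x, 0 ≤ x → IntervalIntegrable g volume 0 x)
    (hF : ∀ x, 0 ≤ x → F x = F 0 + ∫ t in (0 : ℝ)..x, g t) : ContinuousOn F (Ici 0) :=
  (continuousOn_const.add (continuousOn_primitive_Ici hg)).congr fun x hx => hF x hx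

/-- Product rule for a continuously differentiable scalar function and a locally absolutely
continuous vector-valued one, in integrated form. -/
theorem smul_primitive [CompleteSpace E] {w w' : ℝ → ℝ} (hw : ∀ x, HasDerivAt w (w' x) x)
    (hw' : Continuous w') {F g : ℝ → E}
    (hg : ∀ x, 0 ≤ x → IntervalIntegrable g volume 0 x)
    (hF : ∀ x, 0 ≤ x → F x = F 0 + ∫ t in (0 : ℝ)..x, g t) {X : ℝ} (hX : 0 ≤ X) :
    w X • F X = w 0 • F 0 + ∫ t in (0 : ℝ)..X, (w' t • F t + w t • g t) := by
  have hwc : Continuous w := continuous_iff_continuousAt.2 fun x => (hw x).continuousAt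
  have hFc : ContinuousOn F (Ici 0) := continuousOn_Ici_of_primitive hg hF
  have hi1 : ∀ x, 0 ≤ x → IntervalIntegrable (fun t => w' t • F t) volume 0 x := fun x hx =>
    intervalIntegrable_of_continuousOn_Ici (hw'.continuousOn.smul hFc) hx
  have hi2 : ∀ x, 0 ≤ x → IntervalIntegrable (fun t => w t • g t) volume 0 x := fun x hx =>
    (hg x hx).continuousOn_smul hwc.continuousOn
  have hi : ∀ x, 0 ≤ x → IntervalIntegrable (fun t => w' t • F t + w t • g t) volume 0 x :=
    fun x hx => (hi1 x hx).add (hi2 x hx)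
  set H : ℝ → E := fun x => w x • F x - ∫ t in (0 : ℝ)..x, (w' t • F t + w t • g t) with hH
  have hHc : ContinuousOn H (Ici 0) :=
    (hwc.continuousOn.smul hFc).sub (continuousOn_primitive_Ici hi)
  obtain ⟨C, hC⟩ := (isCompact_Icc (a := (0 : ℝ)) (b := X)).exists_bound_of_continuousOn
    hw'.continuousOn
  set G : ℝ → ℝ := fun x => ∫ t in (0 : ℝ)..x, ‖g t‖ with hG
  have hgn : ∀ x, 0 ≤ x → IntervalIntegrable (fun t => ‖g t‖) volume 0 x := fun x hx =>
    (hg x hx).norm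
  have hGc : ContinuousOn G (Ici 0) := continuousOn_primitive_Ici hgn
  have hC0 : 0 ≤ C := (norm_nonneg _).trans (hC 0 ⟨le_rfl, hX⟩)
  -- As `G` is continuous, this bound is `o(y - x)` for `y ↓ x`. So `H` has right derivative zero at
  -- every point and is constant, although `F` itself may fail to be differentiable at many points.
  have key : ∀ x y, 0 ≤ x → x ≤ y → y ≤ X → ‖H y - H x‖ ≤ 2 * C * (y - x) * (G y - G x) := by
    intro x y hx hxy hyX
    have hy : 0 ≤ y := hx.trans hxy
    have hsub : ∀ {f : ℝ → E}, (∀ x, 0 ≤ x → IntervalIntegrable f volume 0 x) →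
        ∀ a b, 0 ≤ a → 0 ≤ b → (∫ t in (0 : ℝ)..b, f t) - ∫ t in (0 : ℝ)..a, f t =
          ∫ t in a..b, f t := fun hf a b ha hb =>
      intervalIntegral.integral_interval_sub_left (hf b hb) (hf a ha)
    have hGsub : ∀ a b, 0 ≤ a → 0 ≤ b → G b - G a = ∫ t in a..b, ‖g t‖ := fun a b ha hb =>
      intervalIntegral.integral_interval_sub_left (hgn b hb) (hgn a ha)
    have e1 : (w y - w x) • F y = ∫ t in x..y, w' t • F y := by
      rw [intervalIntegral.integral_smul_const, intervalIntegral.integral_eq_sub_of_hasDerivAt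
        (fun t _ => hw t) (hw'.intervalIntegrable _ _)]
    have e2 : w x • (F y - F x) = ∫ t in x..y, w x • g t := by
      rw [intervalIntegral.integral_smul, hF y hy, hF x hx, add_sub_add_left_eq_sub,
        hsub hg x y hx hy]
    -- The increment of `w • F` is split with `F` frozen at `y` and `w` frozen at `x`, so that each
    -- remaining term is a product of two small factors.
    have e3 : H y - H x = ∫ t in x..y, (w' t • (F y - F t) + (w x - w t) • g t) := by
      have : H y - H x = ((w y - w x) • F y + w x • (F y - F x)) -
          ((∫ t in (0 : ℝ)..y, (w' t • F t + w t • g t)) -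
            ∫ t in (0 : ℝ)..x, (w' t • F t + w t • g t)) := by
        simp only [hH]; module
      rw [this, hsub hi x y hx hy, e1, e2, ← intervalIntegral.integral_add,
        ← intervalIntegral.integral_sub]
      · refine intervalIntegral.integral_congr fun t _ => ?_
        module
      · exact ((hw'.smul continuous_const).intervalIntegrable _ _).add
          ((intervalIntegrable_of_nonneg hg hx hy).smul (w x))
      · exact intervalIntegrable_of_nonneg hi hx hy
      · exact (hw'.smul continuous_const).intervalIntegrable _ _
      · exact (intervalIntegrable_of_nonneg hg hx hy).smul (w x)
    have hGmono : ∀ t ∈ Ioc x y, ‖F y - F t‖ ≤ G y - G x := fun t ht => by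
      have ht0 : 0 ≤ t := hx.trans ht.1.le
      rw [hF y hy, hF t ht0, add_sub_add_left_eq_sub, hsub hg t y ht0 hy, hGsub x y hx hy]
      refine (intervalIntegral.norm_integral_le_integral_norm ht.2).trans ?_
      exact intervalIntegral.integral_mono_interval ht.1.le ht.2 le_rfl
        (Eventually.of_forall fun _ => norm_nonneg _) (intervalIntegrable_of_nonneg hgn hx hy)
    have hlip : ∀ t ∈ Ioc x y, |w x - w t| ≤ C * (y - x) := fun t ht => by
      have := (convex_Icc (0 : ℝ) X).norm_image_sub_le_of_norm_hasDerivWithin_le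
        (f := w) (f' := w') (C := C) (fun s _ => (hw s).hasDerivWithinAt) hC
        (x := t) (y := x) ⟨hx.trans ht.1.le, ht.2.trans hyX⟩ ⟨hx, hxy.trans hyX⟩
      rw [Real.norm_eq_abs, Real.norm_eq_abs, abs_sub_comm x t, abs_of_pos (sub_pos.2 ht.1)] at this
      exact this.trans (by gcongr; exact ht.2)
    rw [e3]
    have hbi : IntervalIntegrable (fun t => C * (G y - G x) + C * (y - x) * ‖g t‖) volume x y :=
      intervalIntegrable_const.add ((intervalIntegrable_of_nonneg hgn hx hy).const_mul _)
    refine (intervalIntegral.norm_integral_le_of_norm_le hxy (Eventually.of_forall fun t ht => ?_)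
      hbi).trans (le_of_eq ?_)
    · refine (norm_add_le _ _).trans ?_
      rw [norm_smul, norm_smul]
      have h1 := hC t ⟨hx.trans ht.1.le, ht.2.trans hyX⟩
      have h2 := hGmono t ht
      have h3 := hlip t ht
      rw [← Real.norm_eq_abs] at h3
      gcongr
    · rw [intervalIntegral.integral_add intervalIntegrable_const
        ((intervalIntegrable_of_nonneg hgn hx hy).const_mul _),
        intervalIntegral.integral_const_mul (C * (y - x)), ← hGsub x y hx hy]
      simp
      ring
  have hconst := constant_of_has_deriv_right_zero (a := 0) (b := X)
    (hHc.mono Icc_subset_Ici_self)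
    (fun x hx => by
      rw [hasDerivWithinAt_iff_isLittleO, Asymptotics.isLittleO_iff]
      intro c hc
      have hGx : Tendsto (fun y => 2 * C * (G y - G x)) (𝓝[Ici x] x) (𝓝 (2 * C * (G x - G x))) :=
        (((hGc x hx.1).mono (Ici_subset_Ici.2 hx.1)).sub tendsto_const_nhds).const_mul _
      rw [sub_self, mul_zero] at hGx
      have hlt : ∀ᶠ y in 𝓝[Ici x] x, y < X :=
        mem_nhdsWithin_of_mem_nhds (Iio_mem_nhds hx.2)
      filter_upwards [hGx.eventually (gt_mem_nhds hc), hlt, self_mem_nhdsWithin] with y h1 h2 h3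
      have h3' : x ≤ y := h3
      have := key x y hx.1 h3' h2.le
      rw [smul_zero, sub_zero, Real.norm_eq_abs, abs_of_nonneg (sub_nonneg.2 h3')]
      refine this.trans ?_
      rw [mul_right_comm]
      exact mul_le_mul_of_nonneg_right h1.le (sub_nonneg.2 h3')) X ⟨hX, le_rfl⟩
  simp only [hH, intervalIntegral.integral_same, sub_zero] at hconst
  rw [← hconst]
  abel

namespace HasSecondDeriv

variable {φ φ' g : ℝ → E}

theorem continuousOn (h : HasSecondDeriv φ φ' g) : ContinuousOn φ (Ici 0) :=
  fun x hx => (h.hasDeriv x hx).continuousWithinAt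

theorem continuousOn_deriv (h : HasSecondDeriv φ φ' g) : ContinuousOn φ' (Ici 0) :=
  continuousOn_Ici_of_primitive h.integrable h.deriv_eq

theorem eq_integral [CompleteSpace E] (h : HasSecondDeriv φ φ' g) {x : ℝ} (hx : 0 ≤ x) :
    φ x = φ 0 + ∫ t in (0 : ℝ)..x, φ' t := by
  rw [intervalIntegral.integral_eq_sub_of_hasDeriv_right_of_le hx
    (h.continuousOn.mono Icc_subset_Ici_self)
    (fun t ht => (h.hasDeriv t ht.1.le).mono
      ((Ioi_subset_Ioi ht.1.le).trans Ioi_subset_Ici_self))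
    (intervalIntegrable_of_continuousOn_Ici h.continuousOn_deriv hx)]
  abel

/-- Lagrange's identity. -/
theorem lagrange [CompleteSpace E] (h : HasSecondDeriv φ φ' g) {V w w' : ℝ → ℝ}
    (hV : Continuous V) (hw : IsGlobalSolution V w w') {x : ℝ} (hx : 0 ≤ x) :
    w x • φ' x - w' x • φ x =
      w 0 • φ' 0 - w' 0 • φ 0 + ∫ t in (0 : ℝ)..x, w t • (g t - V t • φ t) := by
  have h1 := smul_primitive hw.hasDerivAt hw.continuous' h.integrable h.deriv_eq hx
  have h2 := smul_primitive hw.hasDerivAt' (hV.mul hw.continuous)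
    (fun x hx => intervalIntegrable_of_continuousOn_Ici h.continuousOn_deriv hx)
    (fun x hx => h.eq_integral hx) hx
  have hc1 : IntervalIntegrable (fun t => w' t • φ' t) volume 0 x :=
    intervalIntegrable_of_continuousOn_Ici (hw.continuous'.continuousOn.smul h.continuousOn_deriv) hx
  have hc2 : IntervalIntegrable (fun t => (V t * w t) • φ t) volume 0 x :=
    intervalIntegrable_of_continuousOn_Ici
      ((hV.mul hw.continuous).continuousOn.smul h.continuousOn) hx
  have hc3 : IntervalIntegrable (fun t => w t • g t) volume 0 x :=
    (h.integrable x hx).continuousOn_smul hw.continuous.continuousOn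
  rw [h1, h2, add_sub_add_comm, ← intervalIntegral.integral_sub (hc1.add hc3) (hc2.add hc1)]
  congr 1
  refine intervalIntegral.integral_congr fun t _ => ?_
  module

end HasSecondDeriv

end Primitive

/-! ### Grönwall's inequality and perturbation of the potential. -/

/-- Integral form of Grönwall's inequality with an integrable kernel. -/
theorem le_mul_exp_of_le_integral {f k : ℝ → ℝ} {A X : ℝ} (hX : 0 ≤ X)
    (hf : ContinuousOn f (Ici 0)) (hk : ∀ x, 0 ≤ x → IntervalIntegrable k volume 0 x)
    (hf0 : ∀ x, 0 ≤ x → 0 ≤ f x) (hk0 : ∀ x, 0 ≤ k x)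
    (h : ∀ x, 0 ≤ x → f x ≤ A + ∫ t in (0 : ℝ)..x, k t * f t) :
    f X ≤ A * Real.exp (2 * ∫ t in (0 : ℝ)..X, k t) := by
  have hkf : ∀ x, 0 ≤ x → IntervalIntegrable (fun t => k t * f t) volume 0 x := fun x hx =>
    (hk x hx).mul_continuousOn (hf.mono (by rw [uIcc_of_le hx]; exact Icc_subset_Ici_self))
  set R : ℝ → ℝ := fun x => A + ∫ t in (0 : ℝ)..x, k t * f t with hR
  set Q : ℝ → ℝ := fun x => ∫ t in (0 : ℝ)..x, k t with hQ
  have hRc : ContinuousOn R (Ici 0) := continuousOn_const.add (continuousOn_primitive_Ici hkf)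
  have hQc : ContinuousOn Q (Ici 0) := continuousOn_primitive_Ici hk
  have hRsub : ∀ x y, 0 ≤ x → 0 ≤ y → R y - R x = ∫ t in x..y, k t * f t := fun x y hx hy => by
    simp only [hR, add_sub_add_left_eq_sub]
    exact intervalIntegral.integral_interval_sub_left (hkf y hy) (hkf x hx)
  have hQsub : ∀ x y, 0 ≤ x → 0 ≤ y → Q y - Q x = ∫ t in x..y, k t := fun x y hx hy =>
    intervalIntegral.integral_interval_sub_left (hk y hy) (hk x hx)
  have hRmono : ∀ x y, 0 ≤ x → x ≤ y → R x ≤ R y := fun x y hx hxy => by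
    rw [← sub_nonneg, hRsub x y hx (hx.trans hxy)]
    exact intervalIntegral.integral_nonneg hxy fun t ht => mul_nonneg (hk0 t) (hf0 t (hx.trans ht.1))
  have hstep : ∀ x y, 0 ≤ x → x ≤ y → R y * (1 - (Q y - Q x)) ≤ R x := fun x y hx hxy => by
    have hy := hx.trans hxy
    have : R y - R x ≤ R y * (Q y - Q x) := by
      rw [hRsub x y hx hy, hQsub x y hx hy, ← intervalIntegral.integral_const_mul]
      refine intervalIntegral.integral_mono_on hxy (intervalIntegrable_of_nonneg hkf hx hy)
        ((intervalIntegrable_of_nonneg hk hx hy).const_mul _) fun t ht => ?_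
      rw [mul_comm]
      exact mul_le_mul_of_nonneg_right ((h t (hx.trans ht.1)).trans
        (hRmono t y (hx.trans ht.1) ht.2)) (hk0 t)
    linarith
  -- Continuous induction on `[0, X]`: the kernel is only integrable, so `R` need not be
  -- differentiable everywhere.
  have hsub : Icc 0 X ⊆ {x | R x ≤ A * Real.exp (2 * Q x)} := by
    refine IsClosed.Icc_subset_of_forall_mem_nhdsWithin ?_ (by simp [hR, hQ]) ?_
    · have := ContinuousOn.preimage_isClosed_of_isClosed
        (f := fun x => A * Real.exp (2 * Q x) - R x) (s := Icc 0 X) (t := Ici 0)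
        ((((hQc.const_mul 2).rexp.const_mul A).sub hRc).mono Icc_subset_Ici_self)
        isClosed_Icc isClosed_Ici
      rw [inter_comm]
      convert! this using 2
      ext x
      simp
    · rintro x ⟨hx, hx0, hxX⟩
      have hQx : Tendsto (fun y => Q y - Q x) (𝓝[Ici x] x) (𝓝 (Q x - Q x)) :=
        ((hQc x hx0).mono (Ici_subset_Ici.2 hx0)).sub tendsto_const_nhds
      rw [sub_self] at hQx
      have hQx' := hQx.mono_left (nhdsWithin_mono x Ioi_subset_Ici_self)
      filter_upwards [hQx'.eventually (gt_mem_nhds (show (0 : ℝ) < 1 / 2 by norm_num)),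
        self_mem_nhdsWithin] with y hy hxy
      have hxy' : x ≤ y := le_of_lt hxy
      have hd0 : 0 ≤ Q y - Q x := by
        rw [hQsub x y hx0 (hx0.trans hxy')]
        exact intervalIntegral.integral_nonneg hxy' fun t _ => hk0 t
      have hRy : 0 ≤ R y := (hf0 y (hx0.trans hxy')).trans (h y (hx0.trans hxy'))
      set d := Q y - Q x with hd
      -- For `0 ≤ d ≤ 1/2` one has `(1 - d)(1 + 2d) ≥ 1`; this is the origin of the factor 2 in the
      -- exponent.
      have hexp : 1 ≤ (1 - d) * Real.exp (2 * d) := by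
        have := Real.add_one_le_exp (2 * d)
        nlinarith
      have hx' : R x ≤ A * Real.exp (2 * Q x) := hx
      calc R y ≤ R y * ((1 - d) * Real.exp (2 * d)) := le_mul_of_one_le_right hRy hexp
        _ = R y * (1 - d) * Real.exp (2 * d) := by ring
        _ ≤ A * Real.exp (2 * Q x) * Real.exp (2 * d) := by
          exact mul_le_mul_of_nonneg_right ((hstep x y hx0 hxy').trans hx') (Real.exp_pos _).le
        _ = A * Real.exp (2 * Q y) := by
          rw [mul_assoc, ← Real.exp_add, hd]
          ring_nf
  exact (h X hX).trans (hsub ⟨hX, le_rfl⟩)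

/-- Growth of solutions under a perturbation `q` of the potential: backward solutions of the
unperturbed equation that grow at rate `ε` give growth at rate `ε` plus a multiple of `∫ |q|`. -/
theorem IsSolution.abs_le {V₀ q : ℝ → ℝ} (hV₀ : Continuous V₀)
    {ξ : ℝ} (hq : ∀ x, 0 ≤ x → IntervalIntegrable q volume 0 x) {ε A B : ℝ} (hA : 0 ≤ A)
    (hw : ∀ x, 0 ≤ x → ∃ w w', IsGlobalSolution (fun t => V₀ t - ξ) w w' ∧ w x = 0 ∧ w' x = -1 ∧
      (∀ t ∈ Icc 0 x, |w t| ≤ A * Real.exp (ε * (x - t))) ∧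
      |w 0| ≤ B * Real.exp (ε * x) ∧ |w' 0| ≤ B * Real.exp (ε * x))
    {u u' : ℝ → ℝ} (hu : IsSolution (fun x => V₀ x + q x) ξ u u') {bc : BoundaryCondition}
    (hbc : bc.Normalized (u 0) (u' 0)) {x : ℝ} (hx : 0 ≤ x) :
    |u x| ≤ B * Real.exp (ε * x) * Real.exp (2 * (A * ∫ t in (0 : ℝ)..x, |q t|)) := by
  have hV : Continuous fun t => V₀ t - ξ := hV₀.sub continuous_const
  have hrec : ∀ x, 0 ≤ x →
      |u x| ≤ B * Real.exp (ε * x) + ∫ t in (0 : ℝ)..x, A * Real.exp (ε * (x - t)) * |q t| * |u t| := by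
    intro x hx
    obtain ⟨w, w', hws, hwx, hwx', hwb, hw0, hw0'⟩ := hw x hx
    have h := HasSecondDeriv.lagrange hu hV hws hx
    -- With `w(x) = 0` and `w'(x) = -1` the boundary term of Lagrange's identity at `x` is `u(x)`
    -- itself.
    have h1 : u x = (w 0 * u' 0 - w' 0 * u 0) + ∫ t in (0 : ℝ)..x, w t * (q t * u t) := by
      simp only [hwx, hwx', smul_eq_mul] at h
      have : (∫ t in (0 : ℝ)..x, w t * ((V₀ t + q t - ξ) * u t - (V₀ t - ξ) * u t)) =
          ∫ t in (0 : ℝ)..x, w t * (q t * u t) :=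
        intervalIntegral.integral_congr fun t _ => by ring_nf
      rw [this] at h
      linarith
    have h2 : |w 0 * u' 0 - w' 0 * u 0| ≤ B * Real.exp (ε * x) := by
      cases bc
      · rw [hbc.1, hbc.2]; simpa using hw0
      · rw [hbc.1, hbc.2]; simpa using hw0'
    rw [h1]
    refine (abs_add_le _ _).trans (add_le_add h2 ?_)
    have huc : ContinuousOn u (uIcc 0 x) :=
      (HasSecondDeriv.continuousOn hu).mono (by rw [uIcc_of_le hx]; exact Icc_subset_Ici_self)
    rw [← Real.norm_eq_abs (∫ _ in _.._, _)]
    refine intervalIntegral.norm_integral_le_of_norm_le hx (Eventually.of_forall fun t ht => ?_) ?_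
    · rw [Real.norm_eq_abs, abs_mul, abs_mul, ← mul_assoc]
      gcongr
      exact hwb t ⟨ht.1.le, ht.2⟩
    · exact ((hq x hx).abs.continuousOn_mul (by fun_prop)).mul_continuousOn huc.abs
  -- Multiplication by `e^{-εx}` removes the dependence of the kernel on `x` and leaves `A |q(t)|`.
  have hg := le_mul_exp_of_le_integral (f := fun x => |u x| * Real.exp (-(ε * x)))
    (k := fun t => A * |q t|) (A := B) hx
    ((HasSecondDeriv.continuousOn hu).abs.mul (by fun_prop))
    (fun x hx => (hq x hx).abs.const_mul A) (fun x _ => by positivity) (fun x => by positivity)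
    (fun x hx => by
      have := mul_le_mul_of_nonneg_right (hrec x hx) (Real.exp_pos (-(ε * x))).le
      refine this.trans (le_of_eq ?_)
      rw [add_mul, mul_assoc, ← Real.exp_add, add_neg_cancel, Real.exp_zero, mul_one,
        ← intervalIntegral.integral_mul_const]
      congr 1
      refine intervalIntegral.integral_congr fun t _ => ?_
      have : Real.exp (ε * (x - t)) * Real.exp (-(ε * x)) = Real.exp (-(ε * t)) := by
        rw [← Real.exp_add]; ring_nf
      calc A * Real.exp (ε * (x - t)) * |q t| * |u t| * Real.exp (-(ε * x))
          = A * |q t| * |u t| * (Real.exp (ε * (x - t)) * Real.exp (-(ε * x))) := by ring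
        _ = _ := by rw [this]; ring)
  rw [intervalIntegral.integral_const_mul] at hg
  calc |u x| = |u x| * Real.exp (-(ε * x)) * Real.exp (ε * x) := by
        rw [mul_assoc, ← Real.exp_add, neg_add_cancel, Real.exp_zero, mul_one]
    _ ≤ B * Real.exp (2 * (A * ∫ t in (0 : ℝ)..x, |q t|)) * Real.exp (ε * x) := by gcongr
    _ = _ := by ring

/-! ### The recurrence `a(n+2) = D a(n+1) - a(n)`. -/

/-- A real number `D` with `|D| ≤ r + r⁻¹` is the sum of two complex numbers with product `1` and
modulus at most `r`. -/
theorem exists_complex_add_eq_mul_eq_one {D r : ℝ} (hr : 1 ≤ r) (hD : |D| ≤ r + r⁻¹) :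
    ∃ a b : ℂ, a + b = D ∧ a * b = 1 ∧ ‖a‖ ≤ r ∧ ‖b‖ ≤ r := by
  have hr0 : 0 < r := by linarith
  rcases le_total |D| 2 with h | h
  · have hs : 0 ≤ 1 - (D / 2) ^ 2 := by
      have := sq_le_sq' (abs_le.1 h).1 (abs_le.1 h).2
      nlinarith
    set z : ℝ := Real.sqrt (1 - (D / 2) ^ 2) with hz
    have hz2 : z * z = 1 - (D / 2) ^ 2 := Real.mul_self_sqrt hs
    have hn : ∀ y : ℝ, y * y = z * z → ‖(⟨D / 2, y⟩ : ℂ)‖ ≤ r := fun y hy => by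
      rw [Complex.norm_def, Complex.normSq_mk, hy, hz2]
      rw [show D / 2 * (D / 2) + (1 - (D / 2) ^ 2) = 1 by ring]
      simpa using hr
    refine ⟨⟨D / 2, z⟩, ⟨D / 2, -z⟩, ?_, ?_, hn _ rfl, hn _ (by ring)⟩
    · apply Complex.ext <;> simp
    · apply Complex.ext <;> simp
      · nlinarith
      · ring
  · have hs : 0 ≤ (D / 2) ^ 2 - 1 := by
      have := sq_abs D
      nlinarith
    set z : ℝ := Real.sqrt ((D / 2) ^ 2 - 1) with hz
    have hz2 : z * z = (D / 2) ^ 2 - 1 := Real.mul_self_sqrt hs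
    have hz0 : 0 ≤ z := Real.sqrt_nonneg _
    have hzr : |D| / 2 + z ≤ r := by
      have h1 : z ≤ (r - r⁻¹) / 2 := by
        rw [hz, Real.sqrt_le_left (by have := inv_le_one_of_one_le₀ hr; linarith)]
        have h2 : |D| ^ 2 ≤ (r + r⁻¹) ^ 2 := by gcongr
        rw [sq_abs] at h2
        have h3 : r * r⁻¹ = 1 := mul_inv_cancel₀ hr0.ne'
        nlinarith
      linarith
    have hn : ∀ y : ℝ, |y| = z → ‖((D / 2 + y : ℝ) : ℂ)‖ ≤ r := fun y hy => by
      rw [Complex.norm_real, Real.norm_eq_abs]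
      refine (abs_add_le _ _).trans ?_
      rwa [hy, abs_div, abs_two]
    refine ⟨((D / 2 + z : ℝ) : ℂ), ((D / 2 + -z : ℝ) : ℂ), ?_, ?_, hn _ (abs_of_nonneg hz0),
      hn _ (by rw [abs_neg, abs_of_nonneg hz0])⟩
    · push_cast; ring
    · rw [← Complex.ofReal_mul, show (D / 2 + z) * (D / 2 + -z) = (D / 2) ^ 2 - z * z by ring, hz2]
      norm_num

/-- Both characteristic roots have modulus at most `r`. The factor linear in `n` allows for a double
root, which makes the bound uniform in `D` up to the band edges `D = ±2`. -/
theorem abs_le_of_recurrence {a : ℕ → ℝ} {D r B : ℝ} (hr : 1 ≤ r) (hD : |D| ≤ r + r⁻¹) {N : ℕ}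
    (ha : ∀ n, n + 2 ≤ N → a (n + 2) = D * a (n + 1) - a n) (h0 : |a 0| ≤ B) (h1 : |a 1| ≤ B) :
    ∀ n ≤ N, |a n| ≤ r ^ n * B * (1 + 2 * n) := by
  obtain ⟨l, m, hs, hp, hl, hm⟩ := exists_complex_add_eq_mul_eq_one hr hD
  have hB : 0 ≤ B := (abs_nonneg _).trans h0
  -- Removing one root `l` leaves a first-order recurrence with ratio `m`.
  have hb : ∀ n, n + 1 ≤ N → ‖(a (n + 1) : ℂ) - l * a n‖ ≤ r ^ n * ((1 + r) * B) := by
    intro n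
    induction n with
    | zero =>
      intro _
      refine (norm_sub_le _ _).trans ?_
      rw [norm_mul, Complex.norm_real, Complex.norm_real, Real.norm_eq_abs, Real.norm_eq_abs]
      have := mul_le_mul hl h0 (abs_nonneg _) (by linarith)
      simp only [zero_add]
      linarith
    | succ n ih =>
      intro hn
      have e : (a (n + 1 + 1) : ℂ) - l * a (n + 1) = m * (a (n + 1) - l * a n) := by
        rw [ha n hn]
        push_cast
        linear_combination (-(a (n + 1) : ℂ)) * hs + (a n : ℂ) * hp
      rw [e, norm_mul, pow_succ', mul_assoc]
      exact mul_le_mul hm (ih (by omega)) (norm_nonneg _) (by linarith)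
  intro n
  induction n with
  | zero => intro _; simpa using h0
  | succ n ih =>
    intro hn
    have h2 := hb n hn
    have h3 : ‖(a (n + 1) : ℂ)‖ ≤ ‖(a (n + 1) : ℂ) - l * a n‖ + ‖l * (a n : ℂ)‖ := by
      simpa using norm_add_le ((a (n + 1) : ℂ) - l * a n) (l * a n)
    rw [norm_mul, Complex.norm_real, Complex.norm_real, Real.norm_eq_abs, Real.norm_eq_abs] at h3
    have h4 := mul_le_mul hl (ih (by omega)) (abs_nonneg _) (by linarith)
    have h5 : r ^ n * ((1 + r) * B) ≤ r ^ n * ((2 * r) * B) := by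
      gcongr
      linarith
    calc |a (n + 1)| ≤ r ^ n * ((2 * r) * B) + r * (r ^ n * B * (1 + 2 * n)) := by linarith
      _ = r ^ (n + 1) * B * (1 + 2 * (n + 1 : ℕ)) := by push_cast; ring

theorem one_add_two_mul_le_exp {κ : ℝ} (hκ : 0 < κ) (n : ℕ) :
    (1 + 2 * n : ℝ) ≤ (1 + 2 / κ) * Real.exp (κ * n) := by
  have h1 := Real.add_one_le_exp (κ * n)
  have hn : (0 : ℝ) ≤ κ * n := by positivity
  have h2 : (1 : ℝ) ≤ Real.exp (κ * n) := by linarith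
  have h3 : (2 * n : ℝ) = 2 / κ * (κ * n) := by field_simp
  rw [h3, add_mul, one_mul]
  gcongr
  linarith

/-- Growth to the left of a function satisfying the Floquet recurrence. -/
theorem abs_le_of_backward_recurrence {g : ℝ → ℝ} {P D κ B x : ℝ} (hP : 0 < P) (hκ : 0 < κ)
    (hD : |D| ≤ Real.exp κ + Real.exp (-κ))
    (hg : ∀ t, g (t + 2 * P) = D * g (t + P) - g t)
    (hB : ∀ t ∈ Icc (x - 2 * P) x, |g t| ≤ B) {t : ℝ} (ht : t ≤ x) :
    |g t| ≤ (1 + 2 / κ) * B * Real.exp (2 * κ / P * (x - t)) := by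
  set n : ℕ := ⌊(x - t) / P⌋₊ with hn
  have hxt : 0 ≤ (x - t) / P := div_nonneg (sub_nonneg.2 ht) hP.le
  have hn1 : (n : ℝ) ≤ (x - t) / P := Nat.floor_le hxt
  have hn2 : (x - t) / P < n + 1 := Nat.lt_floor_add_one _
  have hn1' : n * P ≤ x - t := (le_div_iff₀ hP).1 hn1
  have hn2' : x - t < (n + 1) * P := (div_lt_iff₀ hP).1 hn2
  have hB0 : 0 ≤ B := (abs_nonneg _).trans (hB x ⟨by linarith, le_rfl⟩)
  -- The samples start in the last period before `x` and move left, reaching `t` at `k = n`. The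
  -- first two lie in the window of length `2P`, and the recurrence is invariant under reversal.
  have h := abs_le_of_recurrence (a := fun k : ℕ => g (t + n * P - k * P)) (B := B)
    (r := Real.exp κ) (D := D) (N := n) (Real.one_le_exp hκ.le) (by rwa [← Real.exp_neg])
    (fun k _ => by
      have := hg (t + n * P - (k + 2 : ℕ) * P)
      push_cast at this ⊢
      rw [show t + n * P - (k + 2) * P + 2 * P = t + n * P - k * P by ring,
        show t + n * P - (k + 2) * P + P = t + n * P - (k + 1) * P by ring] at this
      linarith)
    (hB _ ⟨by push_cast; linarith, by push_cast; linarith⟩)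
    (hB _ ⟨by push_cast; linarith, by push_cast; linarith⟩) n le_rfl
  simp only [add_sub_cancel_right] at h
  refine h.trans ?_
  calc Real.exp κ ^ n * B * (1 + 2 * n)
      ≤ Real.exp κ ^ n * B * ((1 + 2 / κ) * Real.exp (κ * n)) := by
        gcongr
        exact one_add_two_mul_le_exp hκ n
    _ = (1 + 2 / κ) * B * Real.exp (2 * κ * n) := by
        rw [← Real.exp_nat_mul, show 2 * κ * n = n * κ + κ * n by ring, Real.exp_add]
        ring
    _ ≤ (1 + 2 / κ) * B * Real.exp (2 * κ / P * (x - t)) := by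
        rw [show 2 * κ / P * (x - t) = 2 * κ * ((x - t) / P) by ring]
        gcongr

/-! ### The discriminant: recurrence, growth of solutions and Lipschitz dependence. -/

/-- `D` is the discriminant (trace of the monodromy matrix) of `u'' = V u` over the period `P`. -/
def IsDiscriminant (V : ℝ → ℝ) (P D : ℝ) : Prop :=
  ∃ c c' s s' : ℝ → ℝ, IsGlobalSolution V c c' ∧ IsGlobalSolution V s s' ∧
    c 0 = 1 ∧ c' 0 = 0 ∧ s 0 = 0 ∧ s' 0 = 1 ∧ D = c P + s' P

theorem exists_isDiscriminant {V : ℝ → ℝ} (hV : Continuous V) {K : ℝ} (hK : ∀ x, |V x| ≤ K)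
    (P : ℝ) : ∃ D, IsDiscriminant V P D := by
  obtain ⟨c, c', hc, hc0, hc0'⟩ := exists_globalSolution hV hK 0 1 0
  obtain ⟨s, s', hs, hs0, hs0'⟩ := exists_globalSolution hV hK 0 0 1
  exact ⟨_, c, c', s, s', hc, hs, hc0, hc0', hs0, hs0', rfl⟩

namespace IsDiscriminant

variable {V : ℝ → ℝ} {P D K : ℝ}

/-- This is Cayley–Hamilton for the monodromy matrix, whose determinant is 1 by constancy of the
Wronskian. It is checked on the data at 0 and extended to all `t` by uniqueness. -/
theorem recurrence (hD : IsDiscriminant V P D) (hV : Function.Periodic V P)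
    (hK : ∀ x, |V x| ≤ K) {u u' : ℝ → ℝ} (hu : IsGlobalSolution V u u') (t : ℝ) :
    u (t + 2 * P) = D * u (t + P) - u t ∧ u' (t + 2 * P) = D * u' (t + P) - u' t := by
  obtain ⟨c, c', s, s', hc, hs, hc0, hc0', hs0, hs0', rfl⟩ := hD
  have hrep : ∀ {v v' : ℝ → ℝ}, IsGlobalSolution V v v' → ∀ x,
      v x = v 0 * c x + v' 0 * s x ∧ v' x = v 0 * c' x + v' 0 * s' x := fun hv x =>
    hv.eq_of_initial (hc.linear_comb hs _ _) hK (by simp [hc0, hs0]) (by simp [hc0', hs0']) x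
  have hu1 := hu.shift_periodic hV
  have hu2 := hu1.shift_periodic hV
  have hw := hc.wronskian_eq hs P
  rw [hc0, hc0', hs0, hs0'] at hw
  have e1 := hrep hu P
  have e2 := hrep hu1 P
  simp only [zero_add] at e2
  have key := ((hu2.linear_comb hu1 1 (-(c P + s' P))).linear_comb hu 1 1).eq_zero hK
    (by simp only [zero_add]
        rw [e2.1, e1.1, e1.2]
        linear_combination (-u 0) * hw)
    (by simp only [zero_add]
        rw [e2.2, e1.1, e1.2]
        linear_combination (-u' 0) * hw) t
  rw [show t + 2 * P = t + P + P by ring]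
  constructor <;> linarith [key.1, key.2]

/-- Growth to the left of the solution with data `(0, -1)` at `x`. -/
theorem backward_bound (hD : IsDiscriminant V P D) (hV : Function.Periodic V P) (hP : 0 < P)
    (hK1 : 1 ≤ K) (hK : ∀ x, |V x| ≤ K) {κ : ℝ} (hκ : 0 < κ)
    (hDκ : |D| ≤ Real.exp κ + Real.exp (-κ)) {w w' : ℝ → ℝ} (hw : IsGlobalSolution V w w') {x : ℝ}
    (hx : w x = 0) (hx' : w' x = -1) {t : ℝ} (ht : t ≤ x) :
    |w t| ≤ (1 + 2 / κ) * Real.exp (K * (2 * P)) * Real.exp (2 * κ / P * (x - t)) ∧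
    |w' t| ≤ (1 + 2 / κ) * Real.exp (K * (2 * P)) * Real.exp (2 * κ / P * (x - t)) := by
  have hb : ∀ t ∈ Icc (x - 2 * P) x,
      |w t| ≤ Real.exp (K * (2 * P)) ∧ |w' t| ≤ Real.exp (K * (2 * P)) := fun t ht => by
    have h := hw.bound_left hK1 hK (δ := 1) (a := x) (by simp [hx]) (by simp [hx']) ht.2
    rw [one_mul] at h
    have hle : Real.exp (K * (x - t)) ≤ Real.exp (K * (2 * P)) := by
      gcongr
      linarith [ht.1]
    exact ⟨h.1.trans hle, h.2.trans hle⟩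
  exact ⟨abs_le_of_backward_recurrence hP hκ hDκ (fun t => (hD.recurrence hV hK hw t).1)
    (fun t ht => (hb t ht).1) ht,
    abs_le_of_backward_recurrence hP hκ hDκ (fun t => (hD.recurrence hV hK hw t).2)
    (fun t ht => (hb t ht).2) ht⟩

/-- The discriminant depends Lipschitz continuously on the potential. -/
theorem abs_sub_le {V₁ V₂ : ℝ → ℝ} {D₁ D₂ δ : ℝ} (h₁ : IsDiscriminant V₁ P D₁)
    (h₂ : IsDiscriminant V₂ P D₂) (hP : 0 ≤ P) (hK : 1 ≤ K) (hK₁ : ∀ x, |V₁ x| ≤ K)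
    (hK₂ : ∀ x, |V₂ x| ≤ K) (hδ : ∀ x, |V₁ x - V₂ x| ≤ δ) :
    |D₁ - D₂| ≤ 2 * (δ * Real.exp (K * P) * Real.exp (K * P)) := by
  have hδ0 : 0 ≤ δ := (abs_nonneg _).trans (hδ 0)
  have main : ∀ {u u' v v' : ℝ → ℝ}, IsGlobalSolution V₁ u u' → IsGlobalSolution V₂ v v' →
      u 0 = v 0 → u' 0 = v' 0 → |v 0| ≤ 1 → |v' 0| ≤ 1 →
      |u P - v P| ≤ δ * Real.exp (K * P) * Real.exp (K * P) ∧
      |u' P - v' P| ≤ δ * Real.exp (K * P) * Real.exp (K * P) := by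
    intro u u' v v' hu hv h0 h0' hv0 hv0'
    have h := norm_le_gronwallBound_of_second_deriv (d := fun x => u x - v x)
      (d' := fun x => u' x - v' x) (e := fun x => V₁ x * u x - V₂ x * v x) (K := K)
      (η := δ * Real.exp (K * P)) (δ := 0) (T := P) hK (by positivity)
      (fun x => (hu.hasDerivAt x).sub (hv.hasDerivAt x))
      (fun x => (hu.hasDerivAt' x).sub (hv.hasDerivAt' x))
      (fun x hx => by
        have hvx := (hv.bound_right hK hK₂ hv0 hv0' hx.1).1
        rw [one_mul] at hvx
        -- The difference solves the equation with potential `V₁` and forcing `(V₁ - V₂) v`.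
        rw [show V₁ x * u x - V₂ x * v x = V₁ x * (u x - v x) + (V₁ x - V₂ x) * v x by ring]
        refine (abs_add_le _ _).trans ?_
        rw [abs_mul, abs_mul]
        gcongr
        · exact hK₁ x
        · exact hδ x
        · refine hvx.trans ?_
          gcongr
          exact hx.2)
      (by simp [h0]) (by simp [h0']) P ⟨hP, le_rfl⟩
    have hg : gronwallBound 0 K (δ * Real.exp (K * P)) P ≤
        δ * Real.exp (K * P) * Real.exp (K * P) := by
      rw [gronwallBound_of_K_ne_0 (by linarith)]
      simp only [zero_mul, zero_add]
      have h1 : (1 : ℝ) ≤ Real.exp (K * P) := Real.one_le_exp (by positivity)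
      refine mul_le_mul (div_le_self (by positivity) hK) (by linarith) (by linarith)
        (by positivity)
    exact ⟨h.1.trans hg, h.2.trans hg⟩
  obtain ⟨c, c', s, s', hc, hs, hc0, hc0', hs0, hs0', rfl⟩ := h₁
  obtain ⟨d, d', r, r', hd, hr, hd0, hd0', hr0, hr0', rfl⟩ := h₂
  have e1 := (main hc hd (by rw [hc0, hd0]) (by rw [hc0', hd0']) (by simp [hd0])
    (by simp [hd0'])).1
  have e2 := (main hs hr (by rw [hs0, hr0]) (by rw [hs0', hr0']) (by simp [hr0])
    (by simp [hr0'])).2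
  rw [show c P + s' P - (d P + r' P) = (c P - d P) + (s' P - r' P) by ring]
  exact (abs_add_le _ _).trans (by linarith)

end IsDiscriminant

/-! ### Energies below the potential, Floquet solutions and exponential dichotomy. -/

theorem one_le_of_one_le_sq {f : ℝ → ℝ} (hf : Continuous f) (h0 : f 0 = 1)
    (h : ∀ x, 0 ≤ x → 1 ≤ f x ^ 2) {x : ℝ} (hx : 0 ≤ x) : 1 ≤ f x := by
  by_contra! hlt
  have h1 : f x ≤ 0 := by
    by_contra! hpos
    nlinarith [h x hx]
  obtain ⟨y, hy, hy0⟩ := intermediate_value_Icc' hx hf.continuousOn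
    (show (0 : ℝ) ∈ Icc (f x) (f 0) from ⟨h1, by rw [h0]; norm_num⟩)
  have := h y hy.1
  rw [hy0] at this
  norm_num at this

theorem monotoneOn_Ici_of_hasDerivAt {f f' : ℝ → ℝ} (hf : ∀ x, HasDerivAt f (f' x) x)
    (h : ∀ x, 0 ≤ x → 0 ≤ f' x) : MonotoneOn f (Ici 0) :=
  monotoneOn_of_hasDerivWithinAt_nonneg (convex_Ici 0)
    (fun x _ => (hf x).continuousAt.continuousWithinAt) (fun x _ => (hf x).hasDerivWithinAt)
    (fun x hx => h x (interior_subset hx))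

theorem strictMonoOn_Ici_of_hasDerivAt {f f' : ℝ → ℝ} (hf : ∀ x, HasDerivAt f (f' x) x)
    (h : ∀ x, 0 < x → 0 < f' x) : StrictMonoOn f (Ici 0) :=
  strictMonoOn_of_hasDerivWithinAt_pos (convex_Ici 0)
    (fun x _ => (hf x).continuousAt.continuousWithinAt) (fun x _ => (hf x).hasDerivWithinAt)
    (fun x hx => h x (by rwa [interior_Ici] at hx))

/-- Below the minimum of the potential the discriminant exceeds `2`. -/
theorem IsDiscriminant.two_lt {V : ℝ → ℝ} {P D : ℝ} (hD : IsDiscriminant V P D) (hP : 0 < P)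
    (hV : ∀ x, 0 < V x) : 2 < D := by
  obtain ⟨c, c', s, s', hc, hs, hc0, hc0', hs0, hs0', rfl⟩ := hD
  -- Convexity: `(u u')' = u'^2 + V u^2 ≥ 0`. Consequently `c^2` and `s'^2` are nondecreasing, since
  -- their derivatives are `2 c c'` and `2 V s s'`.
  have hprod : ∀ {u u' : ℝ → ℝ}, IsGlobalSolution V u u' → u 0 * u' 0 = 0 →
      ∀ x, 0 ≤ x → 0 ≤ u x * u' x := fun {u u'} hu h0 x hx => by
    have := monotoneOn_Ici_of_hasDerivAt (fun x => (hu.hasDerivAt x).mul (hu.hasDerivAt' x))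
      (fun x _ => by nlinarith [mul_nonneg (hV x).le (sq_nonneg (u x)), sq_nonneg (u' x)])
      (self_mem_Ici (a := (0 : ℝ))) hx hx
    simpa [h0] using this
  have hc1 : ∀ x, 0 ≤ x → 1 ≤ c x := fun x hx =>
    one_le_of_one_le_sq hc.continuous hc0 (fun x hx => by
      have := monotoneOn_Ici_of_hasDerivAt (fun x => (hc.hasDerivAt x).pow 2)
        (fun x hx => by
          have := hprod hc (by simp [hc0']) x hx
          norm_num
          linarith) (self_mem_Ici (a := (0 : ℝ))) hx hx
      simpa [hc0] using this) hx
  have hs1 : 1 ≤ s' P :=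
    one_le_of_one_le_sq hs.continuous' hs0' (fun x hx => by
      have := monotoneOn_Ici_of_hasDerivAt (fun x => (hs.hasDerivAt' x).pow 2)
        (fun x hx => by
          have := mul_nonneg (hV x).le (hprod hs (by simp [hs0]) x hx)
          norm_num
          linarith) (self_mem_Ici (a := (0 : ℝ))) hx hx
      simpa [hs0'] using this) hP.le
  have hc'm := strictMonoOn_Ici_of_hasDerivAt hc.hasDerivAt'
    (fun x hx => mul_pos (hV x) (by linarith [hc1 x hx.le]))
  have hcm := strictMonoOn_Ici_of_hasDerivAt hc.hasDerivAt (fun x hx => by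
    have := hc'm (self_mem_Ici (a := (0 : ℝ))) (show x ∈ Ici (0 : ℝ) from hx.le) hx
    rwa [hc0'] at this)
  have := hcm (self_mem_Ici (a := (0 : ℝ))) (show P ∈ Ici (0 : ℝ) from hP.le) hP
  rw [hc0] at this
  linarith

/-- A Floquet solution with multiplier `l`. -/
theorem IsDiscriminant.exists_floquet {V : ℝ → ℝ} {P D K l m : ℝ} (hD : IsDiscriminant V P D)
    (hV : Function.Periodic V P) (hK : ∀ x, |V x| ≤ K) (hs : l + m = D) (hp : l * m = 1)
    (hlm : l ≠ m) : ∃ ψ ψ', IsGlobalSolution V ψ ψ' ∧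
      (∀ x, ψ (x + P) = l * ψ x) ∧ (∀ x, ψ' (x + P) = l * ψ' x) ∧ ¬(ψ 0 = 0 ∧ ψ' 0 = 0) := by
  -- For the translation `M` by `P`, Cayley–Hamilton reads `(M - l)(M - m) = 0`, so `(M - m) w` is
  -- an eigenvector for `l` unless it vanishes.
  have main : ∀ {w w' : ℝ → ℝ}, IsGlobalSolution V w w' →
      ¬(w P - m * w 0 = 0 ∧ w' P - m * w' 0 = 0) → ∃ ψ ψ', IsGlobalSolution V ψ ψ' ∧
      (∀ x, ψ (x + P) = l * ψ x) ∧ (∀ x, ψ' (x + P) = l * ψ' x) ∧ ¬(ψ 0 = 0 ∧ ψ' 0 = 0) := by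
    intro w w' hw hne
    refine ⟨_, _, (hw.shift_periodic hV).linear_comb hw 1 (-m), fun x => ?_, fun x => ?_, ?_⟩
    · have := (hD.recurrence hV hK hw x).1
      rw [show x + 2 * P = x + P + P by ring] at this
      rw [this]
      linear_combination -w (x + P) * hs + w x * hp
    · have := (hD.recurrence hV hK hw x).2
      rw [show x + 2 * P = x + P + P by ring] at this
      rw [this]
      linear_combination -w' (x + P) * hs + w' x * hp
    · simpa [sub_eq_add_neg] using hne
  obtain ⟨c, c', s, s', hc, hs', hc0, hc0', hs0, hs0', hDeq⟩ := id hD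
  -- If it vanished for both `c` and `s`, the trace would be `2m`, contrary to `l ≠ m`.
  by_cases h1 : c P - m * c 0 = 0 ∧ c' P - m * c' 0 = 0
  · refine main hs' fun h2 => hlm ?_
    have e1 := h1.1
    have e2 := h2.2
    rw [hc0] at e1
    rw [hs0'] at e2
    linarith
  · exact main hc h1

/-- With `γ = log|l| / P` the function `|f(x)| e^{-γx}` is continuous and `P`-periodic, hence
bounded. -/
theorem abs_le_exp_of_multiplier {f : ℝ → ℝ} (hf : Continuous f) {P l : ℝ} (hP : 0 < P)
    (hl : l ≠ 0) (h : ∀ x, f (x + P) = l * f x) :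
    ∃ C, 0 ≤ C ∧ ∀ x, |f x| ≤ C * Real.exp (Real.log |l| / P * x) := by
  set γ := Real.log |l| / P with hγ
  have hper : Function.Periodic (fun x => |f x| * Real.exp (-(γ * x))) P := fun x => by
    simp only
    rw [h, abs_mul, show -(γ * (x + P)) = -(γ * x) + -Real.log |l| by rw [hγ]; field_simp; ring,
      Real.exp_add, Real.exp_neg (Real.log |l|), Real.exp_log (abs_pos.2 hl)]
    have := abs_pos.2 hl
    field_simp
  have hcomp := hper.compact_of_continuous hP.ne' (by fun_prop)
  obtain ⟨C, hC⟩ := hcomp.bddAbove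
  have hC' : ∀ x, |f x| * Real.exp (-(γ * x)) ≤ C := fun x => hC (mem_range_self x)
  refine ⟨C, le_trans (by positivity) (hC' 0), fun x => ?_⟩
  have := mul_le_mul_of_nonneg_right (hC' x) (Real.exp_pos (γ * x)).le
  rwa [mul_assoc, ← Real.exp_add, neg_add_cancel, Real.exp_zero, mul_one] at this

/-- Outside `|D| ≤ 2` the equation has an exponential dichotomy. -/
theorem IsDiscriminant.exists_dichotomy {V : ℝ → ℝ} {P D K : ℝ} (hD : IsDiscriminant V P D)
    (hV : Function.Periodic V P) (hK : ∀ x, |V x| ≤ K) (hP : 0 < P) (hD2 : 2 < |D|) :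
    ∃ ψ ψ' χ χ' : ℝ → ℝ, IsGlobalSolution V ψ ψ' ∧ IsGlobalSolution V χ χ' ∧
      ψ 0 * χ' 0 - ψ' 0 * χ 0 = 1 ∧ ∃ C γ, 0 ≤ C ∧ 0 < γ ∧
      (∀ x, |ψ x| ≤ C * Real.exp (-γ * x)) ∧ ∀ x, |χ x| ≤ C * Real.exp (γ * x) := by
  obtain ⟨l, m, hs, hp, hl1⟩ : ∃ l m : ℝ, l + m = D ∧ l * m = 1 ∧ |l| < 1 := by
    have hz : 0 ≤ (D / 2) ^ 2 - 1 := by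
      have := sq_abs D
      nlinarith
    set z : ℝ := Real.sqrt ((D / 2) ^ 2 - 1) with hzdef
    have hz2 : z * z = (D / 2) ^ 2 - 1 := Real.mul_self_sqrt hz
    have hz0 : 0 ≤ z := Real.sqrt_nonneg _
    rcases le_total 0 D with h | h
    · rw [abs_of_nonneg h] at hD2
      refine ⟨D / 2 - z, D / 2 + z, by ring, by nlinarith, ?_⟩
      rw [abs_lt]
      constructor <;> nlinarith
    · rw [abs_of_nonpos h] at hD2
      refine ⟨D / 2 + z, D / 2 - z, by ring, by nlinarith, ?_⟩
      rw [abs_lt]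
      constructor <;> nlinarith
  have hl0 : l ≠ 0 := left_ne_zero_of_mul_eq_one hp
  have hm0 : m ≠ 0 := right_ne_zero_of_mul_eq_one hp
  have hlm : l ≠ m := by
    rintro rfl
    have : |l| * |l| = 1 := by rw [← abs_mul, hp, abs_one]
    nlinarith [abs_nonneg l]
  obtain ⟨ψ, ψ', hψ, hψl, hψl', hψ0⟩ := hD.exists_floquet hV hK hs hp hlm
  obtain ⟨χ, χ', hχ, hχm, hχm', hχ0⟩ := hD.exists_floquet hV hK (by rw [add_comm, hs])
    (by rw [mul_comm, hp]) hlm.symm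
  have hW : ψ 0 * χ' 0 - ψ' 0 * χ 0 ≠ 0 := by
    intro hW
    -- Translating `aψ + bχ = 0` by `P` gives `l aψ + m bχ = 0`; as `l ≠ m`, this forces `aψ = 0`.
    have key : ∀ a b : ℝ, a * ψ 0 + b * χ 0 = 0 → a * ψ' 0 + b * χ' 0 = 0 → a = 0 := by
      intro a b h1 h2
      have hz := (hψ.linear_comb hχ a b).eq_zero hK h1 h2
      have e : ∀ x, a * ψ x = 0 ∧ a * ψ' x = 0 := fun x => by
        have h3 := hz (x + P)
        have h4 := hz x
        rw [hψl, hχm, hψl', hχm'] at h3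
        have hne : l - m ≠ 0 := sub_ne_zero.2 hlm
        constructor
        · refine (mul_eq_zero.1 (?_ : (l - m) * (a * ψ x) = 0)).resolve_left hne
          linear_combination h3.1 - m * h4.1
        · refine (mul_eq_zero.1 (?_ : (l - m) * (a * ψ' x) = 0)).resolve_left hne
          linear_combination h3.2 - m * h4.2
      by_contra ha
      exact hψ0 ⟨(mul_eq_zero.1 (e 0).1).resolve_left ha, (mul_eq_zero.1 (e 0).2).resolve_left ha⟩
    exact hχ0 ⟨key (χ 0) (-ψ 0) (by ring) (by linarith), key (χ' 0) (-ψ' 0) (by linarith) (by ring)⟩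
  obtain ⟨C₁, hC₁, hb₁⟩ := abs_le_exp_of_multiplier hψ.continuous hP hl0 hψl
  obtain ⟨C₂, hC₂, hb₂⟩ := abs_le_exp_of_multiplier hχ.continuous hP hm0 hχm
  have hlog : Real.log |m| = -Real.log |l| := by
    rw [eq_neg_iff_add_eq_zero, ← Real.log_mul (abs_pos.2 hm0).ne' (abs_pos.2 hl0).ne', ← abs_mul,
      mul_comm, hp, abs_one, Real.log_one]
  set W := ψ 0 * χ' 0 - ψ' 0 * χ 0 with hWdef
  -- The growing solution is `W⁻¹ χ`, which normalizes the Wronskian to 1. The two rates are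
  -- opposite because `l m = 1`.
  refine ⟨ψ, ψ', _, _, hψ, hχ.linear_comb hχ W⁻¹ 0, ?_, max C₁ (|W⁻¹| * C₂),
    -(Real.log |l|) / P, le_max_of_le_left hC₁, ?_, fun x => ?_, fun x => ?_⟩
  · have : W⁻¹ * W = 1 := inv_mul_cancel₀ hW
    rw [← this, hWdef]
    ring
  · have := Real.log_neg (abs_pos.2 hl0) hl1
    exact div_pos (by linarith) hP
  · rw [show -(-Real.log |l| / P) = Real.log |l| / P by ring]
    exact (hb₁ x).trans (by gcongr; exact le_max_left _ _)
  · rw [zero_mul, add_zero, abs_mul, ← hlog]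
    calc |W⁻¹| * |χ x| ≤ |W⁻¹| * (C₂ * Real.exp (Real.log |m| / P * x)) := by
          gcongr
          exact hb₂ x
      _ = |W⁻¹| * C₂ * Real.exp (Real.log |m| / P * x) := by ring
      _ ≤ _ := by gcongr; exact le_max_right _ _

/-! ### The Green function in L². -/

open scoped ENNReal

/-- Schur's test for a convolution kernel. -/
theorem lintegral_sq_lintegral_kernel_le {k h : ℝ → ℝ≥0∞} (hk : Measurable k)
    (hh : AEMeasurable h (volume.restrict (Ioi 0))) :
    ∫⁻ x in Ioi 0, (∫⁻ t in Ioi 0, k (x - t) * h t) ^ 2 ≤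
      (∫⁻ s, k s) ^ 2 * ∫⁻ t in Ioi 0, h t ^ 2 := by
  set μ : Measure ℝ := volume.restrict (Ioi 0) with hμ
  -- Cauchy–Schwarz with `k = k^{1/2} k^{1/2}` gives one factor `∫ k`; Tonelli below gives the
  -- other.
  have hpt : ∀ x, (∫⁻ t, k (x - t) * h t ∂μ) ^ 2 ≤
      (∫⁻ s, k s) * ∫⁻ t, k (x - t) * h t ^ 2 ∂μ := by
    intro x
    have hkx : Measurable fun t => k (x - t) := hk.comp (measurable_const.sub measurable_id)
    have hH := ENNReal.lintegral_mul_le_Lp_mul_Lq μ Real.HolderConjugate.two_two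
      (f := fun t => k (x - t) ^ (1 / 2 : ℝ)) (g := fun t => k (x - t) ^ (1 / 2 : ℝ) * h t)
      (hkx.pow_const _).aemeasurable ((hkx.pow_const _).aemeasurable.mul hh)
    have hsq : ∀ a : ℝ≥0∞, a ^ (1 / 2 : ℝ) * a ^ (1 / 2 : ℝ) = a := fun a => by
      rw [← ENNReal.rpow_add_of_nonneg _ _ (by norm_num) (by norm_num)]
      norm_num
    have hsq2 : ∀ a : ℝ≥0∞, (a ^ (1 / 2 : ℝ)) ^ 2 = a := fun a => by rw [sq, hsq]
    have e1 : (fun t => k (x - t) ^ (1 / 2 : ℝ)) * (fun t => k (x - t) ^ (1 / 2 : ℝ) * h t) =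
        fun t => k (x - t) * h t := by
      funext t
      simp only [Pi.mul_apply]
      rw [← mul_assoc, hsq]
    simp only [ENNReal.rpow_two, hsq2, mul_pow, e1] at hH
    calc (∫⁻ t, k (x - t) * h t ∂μ) ^ 2 ≤ _ := pow_le_pow_left₀ (zero_le) hH 2
      _ = (∫⁻ t, k (x - t) ∂μ) * ∫⁻ t, k (x - t) * h t ^ 2 ∂μ := by rw [mul_pow, hsq2, hsq2]
      _ ≤ _ := by
        exact mul_le_mul_left ((setLIntegral_le_lintegral _ _).trans
          (le_of_eq (lintegral_sub_left_eq_self k x))) _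
  calc ∫⁻ x, (∫⁻ t, k (x - t) * h t ∂μ) ^ 2 ∂μ
      ≤ ∫⁻ x, (∫⁻ s, k s) * ∫⁻ t, k (x - t) * h t ^ 2 ∂μ ∂μ := lintegral_mono hpt
    _ ≤ (∫⁻ s, k s) * ∫⁻ t, (∫⁻ s, k s) * h t ^ 2 ∂μ := by
      have hm : AEMeasurable (fun z : ℝ × ℝ => k (z.1 - z.2) * h z.2 ^ 2) (μ.prod μ) :=
        (hk.comp (measurable_fst.sub measurable_snd)).aemeasurable.mul
          ((hh.comp_quasiMeasurePreserving Measure.quasiMeasurePreserving_snd).pow_const 2)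
      rw [lintegral_const_mul'' _ hm.lintegral_prod_right', lintegral_lintegral_swap hm]
      refine mul_le_mul_right (lintegral_mono fun t => ?_) _
      have hkt : Measurable fun x => k (x - t) := hk.comp (measurable_id.sub measurable_const)
      simp only
      rw [lintegral_mul_const'' _ hkt.aemeasurable]
      exact mul_le_mul_left ((setLIntegral_le_lintegral _ _).trans
        (le_of_eq (lintegral_sub_right_eq_self k t))) _
    _ = _ := by
      rw [lintegral_const_mul'' _ (hh.pow_const 2), sq, mul_assoc]

theorem lintegral_exp_neg_abs_lt_top {C γ : ℝ} (hγ : 0 < γ) :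
    ∫⁻ s, ENNReal.ofReal (C * Real.exp (-γ * |s|)) < ∞ := by
  have h : Integrable fun s : ℝ => C * Real.exp (-γ * |s|) := by
    refine Integrable.const_mul ?_ C
    have h1 : IntegrableOn (fun s : ℝ => Real.exp (-γ * |s|)) (Ioi 0) :=
      (exp_neg_integrableOn_Ioi 0 hγ).congr_fun
        (fun s hs => by simp only; rw [abs_of_pos hs]) measurableSet_Ioi
    have h2 : IntegrableOn (fun s : ℝ => Real.exp (-γ * |s|)) (Iio 0) := by
      have := IntegrableOn.comp_neg_Iio (c := 0) (f := fun s : ℝ => Real.exp (-γ * |s|))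
        (by rwa [neg_zero])
      simpa only [abs_neg] using this
    rw [← integrableOn_univ, ← Iic_union_Ioi (a := (0 : ℝ))]
    exact ((integrableOn_Iic_iff_integrableOn_Iio (by finiteness)).2 h2).union h1
  exact h.lintegral_lt_top

theorem memLp_of_abs_le_exp {ψ : ℝ → ℝ} (hψ : Continuous ψ) {C γ : ℝ} (hγ : 0 < γ)
    (h : ∀ x, |ψ x| ≤ C * Real.exp (-γ * x)) :
    MemLp (fun x => (ψ x : ℂ)) 2 (volume.restrict (Ioi 0)) := by
  rw [memLp_two_iff_integrable_sq_norm (by fun_prop)]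
  refine Integrable.mono' (g := fun x => C ^ 2 * Real.exp (-(2 * γ) * x))
    ((exp_neg_integrableOn_Ioi 0 (by positivity)).const_mul _) (by fun_prop)
    (Eventually.of_forall fun x => ?_)
  rw [Complex.norm_real, Real.norm_eq_abs, Real.norm_eq_abs, abs_pow, abs_abs]
  calc |ψ x| ^ 2 ≤ (C * Real.exp (-γ * x)) ^ 2 := by gcongr; exact h x
    _ = C ^ 2 * Real.exp (-(2 * γ) * x) := by
      rw [mul_pow, ← Real.exp_nat_mul]; push_cast; ring_nf

theorem _root_.MeasureTheory.MemLp.intervalIntegrable_zero {f : ℝ → ℂ}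
    (hf : MemLp f 2 (volume.restrict (Ioi 0))) {x : ℝ} (hx : 0 ≤ x) :
    IntervalIntegrable f volume 0 x := by
  rw [intervalIntegrable_iff_integrableOn_Ioc_of_le hx]
  have h := (hf.mono_measure (Measure.restrict_mono Ioc_subset_Ioi_self le_rfl :
    volume.restrict (Ioc 0 x) ≤ volume.restrict (Ioi 0)))
  exact h.integrable (by norm_num)

section Green

variable {V ψ ψ' χ χ' : ℝ → ℝ}

/-- Variation of parameters. -/
theorem hasSecondDeriv_green (hV : Continuous V) (hψ : IsGlobalSolution V ψ ψ')
    (hχ : IsGlobalSolution V χ χ') (hW : ψ 0 * χ' 0 - ψ' 0 * χ 0 = 1) {f : ℝ → ℂ}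
    (hf : ∀ x, 0 ≤ x → IntervalIntegrable f volume 0 x) :
    HasSecondDeriv
      (fun x => ψ x • (∫ t in (0 : ℝ)..x, χ t • f t) - χ x • ∫ t in (0 : ℝ)..x, ψ t • f t)
      (fun x => ψ' x • (∫ t in (0 : ℝ)..x, χ t • f t) - χ' x • ∫ t in (0 : ℝ)..x, ψ t • f t)
      (fun x => V x • (ψ x • (∫ t in (0 : ℝ)..x, χ t • f t) -
        χ x • ∫ t in (0 : ℝ)..x, ψ t • f t) - f x) := by
  have hf1 : ∀ x, 0 ≤ x → IntervalIntegrable (fun t => χ t • f t) volume 0 x := fun x hx =>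
    (hf x hx).continuousOn_smul hχ.continuous.continuousOn
  have hf2 : ∀ x, 0 ≤ x → IntervalIntegrable (fun t => ψ t • f t) volume 0 x := fun x hx =>
    (hf x hx).continuousOn_smul hψ.continuous.continuousOn
  set F : ℝ → ℂ := fun x => ∫ t in (0 : ℝ)..x, χ t • f t with hF
  set G : ℝ → ℂ := fun x => ∫ t in (0 : ℝ)..x, ψ t • f t with hG
  have hFc : ContinuousOn F (Ici 0) := continuousOn_primitive_Ici hf1
  have hGc : ContinuousOn G (Ici 0) := continuousOn_primitive_Ici hf2
  have hF0 : ∀ x, 0 ≤ x → F x = F 0 + ∫ t in (0 : ℝ)..x, χ t • f t := fun x _ => by simp [hF]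
  have hG0 : ∀ x, 0 ≤ x → G x = G 0 + ∫ t in (0 : ℝ)..x, ψ t • f t := fun x _ => by simp [hG]
  have hF00 : F 0 = 0 := by simp [hF]
  have hG00 : G 0 = 0 := by simp [hG]
  have hW' : ∀ x, ψ x * χ' x - ψ' x * χ x = 1 := fun x => (hψ.wronskian_eq hχ x).trans hW
  have hsm : ∀ {w : ℝ → ℝ} {H : ℝ → ℂ}, Continuous w → ContinuousOn H (Ici 0) → ∀ x, 0 ≤ x →
      IntervalIntegrable (fun t => w t • H t) volume 0 x := fun hw hH x hx =>
    intervalIntegrable_of_continuousOn_Ici (hw.continuousOn.smul hH) hx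
  have hsf : ∀ {w : ℝ → ℝ} {v : ℝ → ℝ}, Continuous w → Continuous v → ∀ x, 0 ≤ x →
      IntervalIntegrable (fun t => w t • v t • f t) volume 0 x := fun hw hv x hx =>
    ((hf x hx).continuousOn_smul hv.continuousOn).continuousOn_smul hw.continuousOn
  have hVψ : Continuous fun t => V t * ψ t := hV.mul hψ.continuous
  have hVχ : Continuous fun t => V t * χ t := hV.mul hχ.continuous
  have hφ'c : ContinuousOn (fun x => ψ' x • F x - χ' x • G x) (Ici 0) :=
    (hψ.continuous'.continuousOn.smul hFc).sub (hχ.continuous'.continuousOn.smul hGc)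
  have hφ : ∀ x, 0 ≤ x → ψ x • F x - χ x • G x = ∫ t in (0 : ℝ)..x, (ψ' t • F t - χ' t • G t) := by
    intro x hx
    rw [smul_primitive hψ.hasDerivAt hψ.continuous' hf1 hF0 hx,
      smul_primitive hχ.hasDerivAt hχ.continuous' hf2 hG0 hx, hF00, hG00, smul_zero, smul_zero,
      zero_add, zero_add, ← intervalIntegral.integral_sub
        ((hsm hψ.continuous' hFc x hx).add (hsf hψ.continuous hχ.continuous x hx))
        ((hsm hχ.continuous' hGc x hx).add (hsf hχ.continuous hψ.continuous x hx))]
    refine intervalIntegral.integral_congr fun t _ => ?_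
    module
  refine ⟨fun x hx => ?_, fun x hx => ?_, fun x hx => ?_⟩
  -- Extending the integrand by its value at 0 makes it continuous on the whole line, so the
  -- fundamental theorem also covers the endpoint.
  · set e : ℝ → ℂ := fun t => ψ' (max t 0) • F (max t 0) - χ' (max t 0) • G (max t 0) with he
    have hec : Continuous e := hφ'c.comp_continuous (continuous_id.max continuous_const)
      fun t => le_max_right t 0
    have hmax : ∀ t, 0 ≤ t → e t = ψ' t • F t - χ' t • G t := fun t ht => by
      simp only [he, max_eq_left ht]
    have hd := (hec.integral_hasStrictDerivAt 0 x).hasDerivAt.hasDerivWithinAt (s := Ici 0)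
    rw [hmax x hx] at hd
    have hcongr : ∀ y, 0 ≤ y → ψ y • F y - χ y • G y = ∫ t in (0 : ℝ)..y, e t := fun y hy => by
      rw [hφ y hy]
      refine intervalIntegral.integral_congr fun t ht => ?_
      rw [uIcc_of_le hy] at ht
      exact (hmax t ht.1).symm
    exact hd.congr hcongr (hcongr x hx)
  · refine IntervalIntegrable.sub (intervalIntegrable_of_continuousOn_Ici
      (hV.continuousOn.smul ((hψ.continuous.continuousOn.smul hFc).sub
        (hχ.continuous.continuousOn.smul hGc))) hx) (hf x hx)
  · change ψ' x • F x - χ' x • G x = ψ' 0 • F 0 - χ' 0 • G 0 +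
      ∫ t in (0 : ℝ)..x, (V t • (ψ t • F t - χ t • G t) - f t)
    rw [hF00, hG00, smul_zero, smul_zero, sub_zero, zero_add,
      smul_primitive hψ.hasDerivAt' hVψ hf1 hF0 hx,
      smul_primitive hχ.hasDerivAt' hVχ hf2 hG0 hx, hF00, hG00, smul_zero,
      smul_zero, zero_add, zero_add, ← intervalIntegral.integral_sub
        ((hsm hVψ hFc x hx).add (hsf hψ.continuous' hχ.continuous x hx))
        ((hsm hVχ hGc x hx).add (hsf hχ.continuous' hψ.continuous x hx))]
    refine intervalIntegral.integral_congr fun t _ => ?_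
    -- The derivatives of the two integrals contribute `(ψ'χ - χ'ψ) f`, which is `-f` by the
    -- Wronskian normalization.
    have h1 : f t = (ψ t * χ' t - ψ' t * χ t) • f t := by rw [hW', one_smul]
    conv_rhs => rw [h1]
    module

/-- The solution given by variation of parameters is square integrable if the right-hand side is
orthogonal to the decaying solution. -/
theorem memLp_green (hψ : Continuous ψ) (hχ : Continuous χ) {C γ : ℝ} (hC : 0 ≤ C) (hγ : 0 < γ)
    (hbψ : ∀ x, |ψ x| ≤ C * Real.exp (-γ * x)) (hbχ : ∀ x, |χ x| ≤ C * Real.exp (γ * x))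
    {f : ℝ → ℂ} (hf : MemLp f 2 (volume.restrict (Ioi 0)))
    (h0 : ∫ t in Ioi (0 : ℝ), ψ t • f t = 0) :
    MemLp (fun x => ψ x • (∫ t in (0 : ℝ)..x, χ t • f t) - χ x • ∫ t in (0 : ℝ)..x, ψ t • f t) 2
      (volume.restrict (Ioi 0)) := by
  set k : ℝ → ℝ≥0∞ := fun s => ENNReal.ofReal (C ^ 2 * Real.exp (-γ * |s|)) with hk
  have hint : IntegrableOn (fun t => ψ t • f t) (Ioi 0) := by
    have := (memLp_of_abs_le_exp hψ hγ hbψ).integrable_mul hf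
    exact this.congr (Eventually.of_forall fun t => by simp)
  have hf1 : ∀ x, 0 ≤ x → IntervalIntegrable (fun t => χ t • f t) volume 0 x := fun x hx =>
    (hf.intervalIntegrable_zero hx).continuousOn_smul hχ.continuousOn
  have hf2 : ∀ x, 0 ≤ x → IntervalIntegrable (fun t => ψ t • f t) volume 0 x := fun x hx =>
    (hf.intervalIntegrable_zero hx).continuousOn_smul hψ.continuousOn
  have hC2 : ∀ x t, t ≤ x → |ψ x * χ t| ≤ C ^ 2 * Real.exp (-γ * |x - t|) := fun x t ht => by
    rw [abs_mul, abs_of_nonneg (sub_nonneg.2 ht),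
      show -γ * (x - t) = -γ * x + γ * t by ring, Real.exp_add]
    calc |ψ x| * |χ t| ≤ (C * Real.exp (-γ * x)) * (C * Real.exp (γ * t)) :=
          mul_le_mul (hbψ x) (hbχ t) (abs_nonneg _) (by positivity)
      _ = _ := by ring
  have hpt : ∀ x, 0 < x → ‖ψ x • (∫ t in (0 : ℝ)..x, χ t • f t) -
      χ x • ∫ t in (0 : ℝ)..x, ψ t • f t‖ₑ ≤ ∫⁻ t in Ioi 0, k (x - t) * ‖f t‖ₑ := by
    intro x hx
    have hU : Ioc 0 x ∪ Ioi x = Ioi (0 : ℝ) := Ioc_union_Ioi_eq_Ioi hx.le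
    -- Orthogonality moves the integral against `ψ` to `(x, ∞)`. The growing `χ(x)` is then paired
    -- with `ψ(t)` for `t > x` only, and the kernel is bounded by `C² e^{-γ|x-t|}`.
    have e2 : -(∫ t in (0 : ℝ)..x, ψ t • f t) = ∫ t in Ioi x, ψ t • f t := by
      have := intervalIntegral.integral_interval_add_Ioi (a := 0) (b := x) hint
        (hint.mono_set (Ioi_subset_Ioi hx.le))
      rw [h0] at this
      exact neg_eq_of_add_eq_zero_right this
    rw [sub_eq_add_neg, ← smul_neg, e2, intervalIntegral.integral_of_le hx.le, ← integral_smul,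
      ← integral_smul, ← hU, lintegral_union measurableSet_Ioi
        (Set.disjoint_left.2 fun t h1 h2 => absurd h1.2 (not_le.2 h2))]
    refine (enorm_add_le _ _).trans (add_le_add ?_ ?_)
    · refine (enorm_integral_le_lintegral_enorm _).trans
        (setLIntegral_mono_ae' measurableSet_Ioc (Eventually.of_forall fun t ht => ?_))
      rw [smul_smul, enorm_smul, hk]
      gcongr
      rw [Real.enorm_eq_ofReal_abs]
      exact ENNReal.ofReal_le_ofReal (hC2 x t ht.2)
    · refine (enorm_integral_le_lintegral_enorm _).trans
        (setLIntegral_mono_ae' measurableSet_Ioi (Eventually.of_forall fun t ht => ?_))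
      rw [smul_smul, enorm_smul, hk]
      gcongr
      rw [Real.enorm_eq_ofReal_abs, mul_comm]
      have := hC2 t x (le_of_lt ht)
      rw [abs_sub_comm] at this
      exact ENNReal.ofReal_le_ofReal this
  have hmeas : AEStronglyMeasurable (fun x => ψ x • (∫ t in (0 : ℝ)..x, χ t • f t) -
      χ x • ∫ t in (0 : ℝ)..x, ψ t • f t) (volume.restrict (Ioi 0)) :=
    (((hψ.continuousOn.smul (continuousOn_primitive_Ici hf1)).sub
      (hχ.continuousOn.smul (continuousOn_primitive_Ici hf2))).mono
        Ioi_subset_Ici_self).aestronglyMeasurable measurableSet_Ioi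
  refine ⟨hmeas, ?_⟩
  have hfin : ∫⁻ t in Ioi (0 : ℝ), ‖f t‖ₑ ^ 2 < ∞ := by
    have := (eLpNorm_lt_top_iff_lintegral_rpow_enorm_lt_top (by norm_num) (by norm_num)).1 hf.2
    simpa using this
  rw [eLpNorm_lt_top_iff_lintegral_rpow_enorm_lt_top (by norm_num) (by norm_num)]
  simp only [ENNReal.toReal_ofNat, ENNReal.rpow_two]
  refine lt_of_le_of_lt ?_ (ENNReal.mul_lt_top
    (ENNReal.pow_lt_top (lintegral_exp_neg_abs_lt_top (C := C ^ 2) hγ) (n := 2)) hfin)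
  refine le_trans (setLIntegral_mono_ae' measurableSet_Ioi (Eventually.of_forall fun x hx => ?_))
    (lintegral_sq_lintegral_kernel_le (k := k) (h := fun t => ‖f t‖ₑ) (by fun_prop) hf.1.enorm)
  gcongr
  exact hpt x hx

end Green

/-! ### Fredholm property off the bands. -/

theorem mem_range_of_hasSecondDeriv {V : ℝ → ℝ} {bc : BoundaryCondition} {ξ : ℝ} {f : L2}
    {φ φ' g : ℝ → ℂ} (h : HasSecondDeriv φ φ' g) (hbc : bc.Holds (φ 0) (φ' 0))
    (hφ : MemLp φ 2 (volume.restrict (Ioi 0)))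
    (hg : ∀ᵐ x ∂volume.restrict (Ioi 0), -g x + (V x : ℂ) * φ x = f x + (ξ : ℂ) * φ x) :
    f ∈ LinearMap.range ((schrodinger V bc).toFun - (ξ : ℂ) • (schrodinger V bc).domain.subtype) := by
  have hmem : (hφ.toLp φ, f + (ξ : ℂ) • hφ.toLp φ) ∈ (schrodinger V bc).graph := by
    rw [schrodinger_graph]
    refine ⟨φ, φ', g, h, hbc, hφ.coeFn_toLp, ?_⟩
    filter_upwards [hg, Lp.coeFn_add f ((ξ : ℂ) • hφ.toLp φ), Lp.coeFn_smul (ξ : ℂ) (hφ.toLp φ),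
      hφ.coeFn_toLp] with x h1 h2 h3 h4
    rw [h1, h2, Pi.add_apply, h3, Pi.smul_apply, h4, smul_eq_mul]
  obtain ⟨y, hy1, hy2⟩ := (LinearPMap.mem_graph_iff _).1 hmem
  refine ⟨y, ?_⟩
  rw [LinearMap.sub_apply, LinearMap.smul_apply, Submodule.subtype_apply]
  simp only at hy1 hy2
  rw [hy1]
  exact sub_eq_of_eq_add hy2

/-- By Lagrange's identity an element of the kernel is `φ(0) c + φ'(0) s`, so the kernel embeds in
the image of the subspace `M` of `ℂ²` of coefficients giving square integrable combinations. -/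
theorem finiteDimensional_ker {V : ℝ → ℝ} (hV : Continuous V) {K : ℝ} (hK : ∀ x, |V x| ≤ K)
    (bc : BoundaryCondition) (ξ : ℝ) :
    FiniteDimensional ℂ (LinearMap.ker
      ((schrodinger V bc).toFun - (ξ : ℂ) • (schrodinger V bc).domain.subtype)) := by
  have hVξ : Continuous fun x => V x - ξ := hV.sub continuous_const
  have hKξ : ∀ x, |V x - ξ| ≤ K + |ξ| := fun x => (abs_sub _ _).trans (by linarith [hK x])
  obtain ⟨c, c', hc, hc0, hc0'⟩ := exists_globalSolution hVξ hKξ 0 1 0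
  obtain ⟨s, s', hs, hs0, hs0'⟩ := exists_globalSolution hVξ hKξ 0 0 1
  have hW : ∀ x, c x * s' x - c' x * s x = 1 := fun x => by
    rw [hc.wronskian_eq hs x, hc0, hc0', hs0, hs0']; ring
  set N := LinearMap.ker ((schrodinger V bc).toFun - (ξ : ℂ) • (schrodinger V bc).domain.subtype)
  let M : Submodule ℂ (ℂ × ℂ) :=
    { carrier := {a | MemLp (fun x => a.1 * (c x : ℂ) + a.2 * s x) 2 (volume.restrict (Ioi (0 : ℝ)))}
      zero_mem' := by simp
      add_mem' := fun {a b} ha hb => by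
        refine (MemLp.add ha hb).congr_norm (by have := hc.continuous; have := hs.continuous; fun_prop)
          (Eventually.of_forall fun x => ?_)
        simp only [Pi.add_apply, Prod.fst_add, Prod.snd_add]
        congr 1
        ring
      smul_mem' := fun r a ha => by
        refine (MemLp.const_smul ha r).congr_norm
          (by have := hc.continuous; have := hs.continuous; fun_prop)
          (Eventually.of_forall fun x => ?_)
        simp only [Pi.smul_apply, Prod.smul_fst, Prod.smul_snd, smul_eq_mul]
        congr 1
        ring }
  let T : M →ₗ[ℂ] L2 :=
    { toFun := fun a => MemLp.toLp _ a.2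
      map_add' := fun a b => by
        rw [← MemLp.toLp_add a.2 b.2]
        refine MemLp.toLp_congr _ _ (Eventually.of_forall fun x => ?_)
        simp only [Pi.add_apply, Submodule.coe_add, Prod.fst_add, Prod.snd_add]
        ring
      map_smul' := fun r a => by
        rw [RingHom.id_apply, ← MemLp.toLp_const_smul r a.2]
        refine MemLp.toLp_congr _ _ (Eventually.of_forall fun x => ?_)
        simp only [Pi.smul_apply, Submodule.coe_smul, Prod.smul_fst, Prod.smul_snd, smul_eq_mul]
        ring }
  let J : N →ₗ[ℂ] L2 := (schrodinger V bc).domain.subtype ∘ₗ N.subtype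
  have hJ : Function.Injective J := fun a b hab => Subtype.ext (Subtype.ext hab)
  have hmem : ∀ z, J z ∈ LinearMap.range T := by
    rintro ⟨z, hz⟩
    have hz' : (schrodinger V bc) z = (ξ : ℂ) • (z : L2) := by
      rw [LinearMap.mem_ker, LinearMap.sub_apply, LinearMap.smul_apply, sub_eq_zero] at hz
      exact hz
    have hg := (schrodinger V bc).mem_graph z
    rw [schrodinger_graph] at hg
    obtain ⟨φ, φ', g, h, -, hf, hk⟩ := hg
    simp only at hf hk
    rw [hz'] at hk
    have hgae : ∀ᵐ x, x ∈ Ioi (0 : ℝ) → g x - (V x - ξ) • φ x = 0 := by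
      rw [← ae_restrict_iff' measurableSet_Ioi]
      filter_upwards [hf, hk, Lp.coeFn_smul (ξ : ℂ) (z : L2)] with x h1 h2 h3
      rw [h3, Pi.smul_apply, h1, smul_eq_mul] at h2
      rw [Complex.real_smul]
      push_cast
      linear_combination h2
    have hlag : ∀ {w w' : ℝ → ℝ}, IsGlobalSolution (fun x => V x - ξ) w w' → ∀ x, 0 ≤ x →
        w x • φ' x - w' x • φ x = w 0 • φ' 0 - w' 0 • φ 0 := fun {w w'} hw x hx => by
      rw [h.lagrange hVξ hw hx, intervalIntegral.integral_zero_ae, add_zero]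
      filter_upwards [hgae] with t ht ht'
      rw [uIoc_of_le hx] at ht'
      rw [ht ht'.1, smul_zero]
    have hrep : ∀ x, 0 ≤ x → φ x = φ 0 * c x + φ' 0 * s x := fun x hx => by
      have h1 := hlag hc x hx
      have h2 := hlag hs x hx
      have h3 : ((c x * s' x - c' x * s x : ℝ) : ℂ) = 1 := by rw [hW]; simp
      simp only [hc0, hc0', hs0, hs0', Complex.real_smul] at h1 h2
      push_cast at h1 h2 h3
      linear_combination (s x : ℂ) * h1 - (c x : ℂ) * h2 - φ x * h3
    have hae : (z : L2) =ᵐ[volume.restrict (Ioi 0)] fun x => φ 0 * (c x : ℂ) + φ' 0 * s x := by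
      filter_upwards [hf, ae_restrict_mem measurableSet_Ioi] with x h1 h2
      rw [h1, hrep x (le_of_lt h2)]
    have hm := (memLp_congr_ae hae).1 (Lp.memLp _)
    exact ⟨⟨(φ 0, φ' 0), hm⟩, Lp.ext ((MemLp.coeFn_toLp hm).trans hae.symm)⟩
  exact Module.Finite.of_injective (J.codRestrict _ hmem)
    ((LinearMap.injective_codRestrict_iff _).2 hJ)

/-- The essential spectrum of the periodic operator lies in the set where the discriminant has
modulus at most `2`. -/
theorem abs_discriminant_le_two {V : ℝ → ℝ} (hV : Continuous V) {P D K : ℝ} (hP : 0 < P)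
    (hper : Function.Periodic V P) (hK : ∀ x, |V x| ≤ K) {bc : BoundaryCondition} {ξ : ℝ}
    (hξ : ξ ∈ essentialSpectrum (schrodinger V bc))
    (hD : IsDiscriminant (fun x => V x - ξ) P D) : |D| ≤ 2 := by
  by_contra! hD2
  refine hξ ?_
  have hVξ : Continuous fun x => V x - ξ := hV.sub continuous_const
  have hKξ : ∀ x, |V x - ξ| ≤ K + |ξ| := fun x => (abs_sub _ _).trans (by linarith [hK x])
  obtain ⟨ψ, ψ', χ, χ', hψ, hχ, hW, C, γ, hC, hγ, hbψ, hbχ⟩ :=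
    hD.exists_dichotomy (fun x => by simp only [hper x]) hKξ hP hD2
  have hΨ := memLp_of_abs_le_exp hψ.continuous hγ hbψ
  set S : Submodule ℂ L2 := Submodule.span ℂ {hΨ.toLp _} with hS
  -- The Green solution and its derivative vanish at 0, so it satisfies either boundary condition.
  have hle : Sᗮ ≤ LinearMap.range
      ((schrodinger V bc).toFun - (ξ : ℂ) • (schrodinger V bc).domain.subtype) := by
    intro f hf
    have hfL : MemLp f 2 (volume.restrict (Ioi (0 : ℝ))) := Lp.memLp f
    have h0 : ∫ t in Ioi (0 : ℝ), ψ t • (f : ℝ → ℂ) t = 0 := by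
      rw [hS, Submodule.mem_orthogonal_singleton_iff_inner_right, L2.inner_def] at hf
      rw [← hf]
      refine integral_congr_ae ?_
      filter_upwards [hΨ.coeFn_toLp] with t ht
      rw [ht]
      simp [mul_comm]
    refine mem_range_of_hasSecondDeriv
      (hasSecondDeriv_green hVξ hψ hχ hW fun x hx => hfL.intervalIntegrable_zero hx) ?_
      (memLp_green hψ.continuous hχ.continuous hC hγ hbψ hbχ hfL h0)
      (Eventually.of_forall fun x => ?_)
    · cases bc <;> simp [BoundaryCondition.Holds]
    · simp only [Complex.real_smul]
      push_cast
      ring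
  have hfin : FiniteDimensional ℂ (L2 ⧸ Sᗮ) :=
    LinearEquiv.finiteDimensional (Submodule.quotientEquivOfIsCompl Sᗮ S
      S.isCompl_orthogonal.symm).symm
  -- A subspace containing a closed subspace of finite codimension is itself closed and of finite
  -- codimension.
  refine ⟨finiteDimensional_ker hV hK bc ξ, ?_, ?_⟩
  · exact Submodule.isClosed_mono_of_finiteDimensional_quotient S.isClosed_orthogonal hle
  · exact Submodule.CoFG.of_le hle hfin

/-! ### Averages of `q`, passage to integrals of squares, and high energies. -/

theorem exists_abs_le_of_periodic {p : ℝ → ℝ} {P : ℝ} (hP : 0 < P)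
    (hper : Function.Periodic p P) (hc : Continuous p) : ∃ K, 0 ≤ K ∧ ∀ x, |p x| ≤ K := by
  have hcomp := Function.Periodic.compact_of_continuous (f := fun x => |p x|) (c := P)
    (fun x => by simp only [hper x]) hP.ne' hc.abs
  obtain ⟨K, hK⟩ := hcomp.bddAbove
  have hK' : ∀ x, |p x| ≤ K := fun x => hK (mem_range_self x)
  exact ⟨K, (abs_nonneg _).trans (hK' 0), hK'⟩

/-- Beyond some `Y` the average is below `η`; up to `Y` the integral is at most its value at `Y`. -/
theorem integral_abs_le_of_average_tendsto_zero {q : ℝ → ℝ}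
    (hq : ∀ x, 0 ≤ x → IntervalIntegrable q volume 0 x)
    (h : Tendsto (fun x : ℝ => (1 / x) * ∫ t in (0 : ℝ)..x, |q t|) atTop (𝓝 0)) {η : ℝ}
    (hη : 0 < η) : ∃ C, 0 ≤ C ∧ ∀ x, 0 ≤ x → ∫ t in (0 : ℝ)..x, |q t| ≤ C + η * x := by
  obtain ⟨X, hX⟩ := eventually_atTop.1 (h.eventually (gt_mem_nhds hη))
  set Y := max X 1 with hY
  have hY0 : 0 ≤ Y := le_max_of_le_right zero_le_one
  have hn : 0 ≤ ∫ t in (0 : ℝ)..Y, |q t| := intervalIntegral.integral_nonneg hY0 fun _ _ =>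
    abs_nonneg _
  refine ⟨∫ t in (0 : ℝ)..Y, |q t|, hn, fun x hx => ?_⟩
  rcases le_total x Y with hxY | hxY
  · have : ∫ t in (0 : ℝ)..x, |q t| ≤ ∫ t in (0 : ℝ)..Y, |q t| :=
      intervalIntegral.integral_mono_interval le_rfl hx hxY
        (Eventually.of_forall fun _ => abs_nonneg _) (hq Y hY0).abs
    have h2 : 0 ≤ η * x := by positivity
    linarith
  · have hx1 : 0 < x := lt_of_lt_of_le zero_lt_one ((le_max_right X 1).trans hxY)
    have := hX x ((le_max_left X 1).trans hxY)
    rw [one_div, inv_mul_lt_iff₀ hx1] at this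
    linarith

theorem integral_sq_le_of_abs_le_exp {u : ℝ → ℝ} (hu : ContinuousOn u (Ici 0)) {C ε : ℝ}
    (hε : 0 < ε) (h : ∀ x, 0 ≤ x → |u x| ≤ C * Real.exp (ε / 2 * x)) {L : ℝ} (hL : 0 ≤ L) :
    ∫ x in (0 : ℝ)..L, u x ^ 2 ≤ C ^ 2 / ε * Real.exp (ε * L) := by
  have hd : ∀ x, HasDerivAt (fun x => C ^ 2 / ε * Real.exp (ε * x)) (C ^ 2 * Real.exp (ε * x)) x :=
    fun x => (((hasDerivAt_id x).const_mul ε).exp.const_mul (C ^ 2 / ε)).congr_deriv (by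
      simp only [id]
      field_simp)
  calc ∫ x in (0 : ℝ)..L, u x ^ 2 ≤ ∫ x in (0 : ℝ)..L, C ^ 2 * Real.exp (ε * x) := by
        refine intervalIntegral.integral_mono_on hL
          (intervalIntegrable_of_continuousOn_Ici (hu.pow 2) hL)
          (Continuous.intervalIntegrable (by fun_prop) _ _) fun x hx => ?_
        rw [← sq_abs]
        calc |u x| ^ 2 ≤ (C * Real.exp (ε / 2 * x)) ^ 2 := by gcongr; exact h x hx.1
          _ = C ^ 2 * Real.exp (ε * x) := by
            rw [mul_pow, ← Real.exp_nat_mul]; push_cast; ring_nf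
    _ = C ^ 2 / ε * Real.exp (ε * L) - C ^ 2 / ε * Real.exp (ε * 0) :=
        intervalIntegral.integral_eq_sub_of_hasDerivAt (fun x _ => hd x)
          (Continuous.intervalIntegrable (by fun_prop) _ _)
    _ ≤ _ := sub_le_self _ (by positivity)

/-- At high energy the solutions grow slowly, whatever the potential. -/
theorem IsSolution.abs_le_high_energy {V : ℝ → ℝ} {ξ k : ℝ} (hk : 0 < k) (hξ : k ^ 2 = ξ)
    (hV : ∀ x, 0 ≤ x → IntervalIntegrable V volume 0 x) {u u' : ℝ → ℝ} (hu : IsSolution V ξ u u')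
    {bc : BoundaryCondition} (hbc : bc.Normalized (u 0) (u' 0)) (hk1 : 1 ≤ k) {x : ℝ}
    (hx : 0 ≤ x) : |u x| ≤ Real.exp (2 * (k⁻¹ * ∫ t in (0 : ℝ)..x, |V t|)) := by
  have hu' : IsSolution (fun x => (fun _ => (0 : ℝ)) x + V x) ξ u u' := by simpa using hu
  have hk1' : k⁻¹ ≤ 1 := inv_le_one_of_one_le₀ hk1
  have hsin : ∀ y, |k⁻¹ * Real.sin y| ≤ k⁻¹ := fun y => by
    rw [abs_mul, abs_of_pos (inv_pos.2 hk)]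
    exact mul_le_of_le_one_right (inv_pos.2 hk).le (Real.abs_sin_le_one _)
  -- The unperturbed equation is the free one, so `ε = 0` and the kernel has amplitude `k⁻¹`.
  have h := IsSolution.abs_le (V₀ := fun _ => 0) (ε := 0) (A := k⁻¹) (B := 1) continuous_const hV
    (inv_pos.2 hk).le (fun x _ => by
      refine ⟨fun t => k⁻¹ * Real.sin (k * (x - t)), fun t => -Real.cos (k * (x - t)),
        ⟨fun t => ?_, fun t => ?_⟩, by simp, by simp, fun t _ => ?_, ?_, ?_⟩
      · have h1 : HasDerivAt (fun t => k * (x - t)) (k * -1) t :=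
          ((hasDerivAt_id t).const_sub x).const_mul k
        refine (h1.sin.const_mul k⁻¹).congr_deriv ?_
        field_simp
      · have h1 : HasDerivAt (fun t => k * (x - t)) (k * -1) t :=
          ((hasDerivAt_id t).const_sub x).const_mul k
        refine h1.cos.fun_neg.congr_deriv ?_
        rw [← hξ]
        field_simp
        ring
      · simpa using hsin _
      · simpa using (hsin _).trans hk1'
      · simpa using Real.abs_cos_le_one _) hu' hbc hx
  simpa using h

end HalfLine

/-! ### Choice of constants and conclusion. -/

theorem mainTheorem7 (p q : ℝ → ℝ) (P : ℝ) (hP : 0 < P)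
    (hp_periodic : Function.Periodic p P) (hp_cont : Continuous p)
    (hq_int : LocallyIntegrableOn q (Set.Ici 0))
    (hq_avg : Filter.Tendsto (fun x : ℝ => (1 / x) * ∫ t in (0 : ℝ)..x, |q t|)
      Filter.atTop (nhds 0))
    (bc bc₀ : HalfLine.BoundaryCondition)
    (hess : HalfLine.essentialSpectrum (HalfLine.schrodinger (fun x => p x + q x) bc) =
      HalfLine.essentialSpectrum (HalfLine.schrodinger p bc₀)) :
    HalfLine.RegularityBounds (fun x => p x + q x) bc := by
  intro ε hε
  rw [hess]
  obtain ⟨K₀, hK₀, hpK⟩ := HalfLine.exists_abs_le_of_periodic hP hp_periodic hp_cont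
  have hq : ∀ x, 0 ≤ x → IntervalIntegrable q volume 0 x := fun x hx =>
    (intervalIntegrable_iff_integrableOn_Icc_of_le hx (by finiteness)).2
      (hq_int.integrableOn_compact_subset Icc_subset_Ici_self isCompact_Icc)
  have hpq : ∀ x, 0 ≤ x → IntervalIntegrable (fun x => p x + q x) volume 0 x := fun x hx =>
    (hp_cont.intervalIntegrable _ _).add (hq x hx)
  -- For `k ≥ k₁` the growth rate `2 (K₀ + 1) / k` is at most `ε / 2`.
  set k₁ : ℝ := max 1 (4 * (K₀ + 1) / ε) with hk₁
  have hk₁1 : 1 ≤ k₁ := le_max_left _ _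
  obtain ⟨C₀, hC₀, hqC₀⟩ := HalfLine.integral_abs_le_of_average_tendsto_zero hq hq_avg one_pos
  -- A common bound for `|p - z|` over the energies `z = y, ξ` of the low-energy case.
  set K : ℝ := K₀ + (K₀ + 2 + k₁ ^ 2) with hK
  have hK1 : 1 ≤ K := by nlinarith
  -- The periodic growth rate `2κ / P` becomes `ε / 4`; the bound on `∫|q|` with slope `ε / (8A)`
  -- adds another `ε / 4`. Squaring `u` turns the total `ε / 2` into `ε`.
  set κ : ℝ := ε * P / 8 with hκ
  have hκ0 : 0 < κ := by positivity
  set A : ℝ := (1 + 2 / κ) * Real.exp (K * (2 * P)) with hA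
  have hA0 : 0 < A := by positivity
  obtain ⟨C₁, hC₁, hqC₁⟩ := HalfLine.integral_abs_le_of_average_tendsto_zero hq hq_avg
    (show 0 < ε / (8 * A) by positivity)
  have hexp2 : 0 < Real.exp κ + Real.exp (-κ) - 2 := by
    have h1 := Real.add_one_lt_exp hκ0.ne'
    have h2 := Real.add_one_le_exp (-κ)
    linarith
  -- Energies at distance below `2δ` have discriminants differing by at most `4δ e^{2KP}`, which
  -- must not exceed the margin `e^κ + e^{-κ} - 2`.
  set δ : ℝ := min (1 / 4) ((Real.exp κ + Real.exp (-κ) - 2) /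
    (4 * (Real.exp (K * P) * Real.exp (K * P)))) with hδ
  have hδ0 : 0 < δ := by positivity
  have hδ1 : δ ≤ 1 / 4 := min_le_left _ _
  have hδ2 : 4 * (δ * Real.exp (K * P) * Real.exp (K * P)) ≤ Real.exp κ + Real.exp (-κ) - 2 := by
    have := (le_div_iff₀ (by positivity)).1 (min_le_right (1 / 4)
      ((Real.exp κ + Real.exp (-κ) - 2) / (4 * (Real.exp (K * P) * Real.exp (K * P)))))
    linarith
  set C : ℝ := max (Real.exp (2 * C₀)) (A * Real.exp (2 * (A * C₁))) with hC
  refine ⟨δ, hδ0, C ^ 2 / ε, fun ξ hξ u u' hu hbc L hL => ?_⟩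
  refine HalfLine.integral_sq_le_of_abs_le_exp (HalfLine.HasSecondDeriv.continuousOn hu) hε
    (fun x hx => ?_) hL
  rcases le_total (k₁ ^ 2) ξ with hξ1 | hξ1
  · have hk : k₁ ≤ Real.sqrt ξ := Real.le_sqrt_of_sq_le hξ1
    have hk0 : 0 < Real.sqrt ξ := by linarith
    have h := HalfLine.IsSolution.abs_le_high_energy hk0
      (Real.sq_sqrt (le_trans (by positivity) hξ1)) hpq hu hbc (hk₁1.trans hk) hx
    have hint : ∫ t in (0 : ℝ)..x, |p t + q t| ≤ C₀ + (K₀ + 1) * x := by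
      have h1 : ∫ t in (0 : ℝ)..x, |p t + q t| ≤ ∫ t in (0 : ℝ)..x, (K₀ + |q t|) :=
        intervalIntegral.integral_mono_on hx (hpq x hx).abs
          (intervalIntegrable_const.add (hq x hx).abs) fun t _ =>
            (abs_add_le _ _).trans (by linarith [hpK t])
      rw [intervalIntegral.integral_add intervalIntegrable_const (hq x hx).abs] at h1
      have h2 := hqC₀ x hx
      simp only [intervalIntegral.integral_const, sub_zero, smul_eq_mul] at h1
      linarith
    have hkinv : (Real.sqrt ξ)⁻¹ * ∫ t in (0 : ℝ)..x, |p t + q t| ≤ C₀ + ε / 4 * x := by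
      have hk4 : (K₀ + 1) * 4 ≤ ε * Real.sqrt ξ := by
        have := (le_max_right 1 (4 * (K₀ + 1) / ε)).trans hk
        rw [div_le_iff₀ hε] at this
        linarith
      rw [inv_mul_le_iff₀ hk0]
      have h3 : C₀ ≤ Real.sqrt ξ * C₀ := le_mul_of_one_le_left hC₀ (hk₁1.trans hk)
      have h4 := mul_le_mul_of_nonneg_right hk4 hx
      linarith
    refine h.trans ?_
    calc Real.exp (2 * ((Real.sqrt ξ)⁻¹ * ∫ t in (0 : ℝ)..x, |p t + q t|))
        ≤ Real.exp (2 * C₀ + ε / 2 * x) := Real.exp_le_exp.2 (by linarith)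
      _ = Real.exp (2 * C₀) * Real.exp (ε / 2 * x) := Real.exp_add _ _
      _ ≤ _ := by gcongr; exact le_max_left _ _
  -- Doubling `δ` gives an actual point of the essential spectrum without requiring the distance to
  -- be attained.
  · obtain ⟨y, hy, hξy⟩ := Metric.mem_thickening_iff.1
      (Metric.cthickening_subset_thickening' (show 0 < 2 * δ by positivity) (by linarith) _ hξ)
    rw [Real.dist_eq, abs_lt] at hξy
    have hbdd : ∀ z : ℝ, ∀ t, |p t - z| ≤ K₀ + |z| := fun z t =>
      (abs_sub _ _).trans (by linarith [hpK t])
    have hcont : ∀ z : ℝ, Continuous fun t => p t - z := fun z => hp_cont.sub continuous_const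
    obtain ⟨Dy, hDy⟩ := HalfLine.exists_isDiscriminant (hcont y) (hbdd y) P
    obtain ⟨D, hD⟩ := HalfLine.exists_isDiscriminant (hcont ξ) (hbdd ξ) P
    have hDy2 := HalfLine.abs_discriminant_le_two hp_cont hP hp_periodic hpK hy hDy
    have hyK : -K₀ ≤ y := by
      by_contra! hlt
      have := hDy.two_lt hP fun t => by linarith [(abs_le.1 (hpK t)).1]
      linarith [le_abs_self Dy]
    have hKy : ∀ t, |p t - y| ≤ K := fun t => (hbdd y t).trans (by
      rw [hK]
      gcongr
      exact abs_le.2 ⟨by nlinarith, by nlinarith⟩)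
    have hKξ : ∀ t, |p t - ξ| ≤ K := fun t => (hbdd ξ t).trans (by
      rw [hK]
      gcongr
      exact abs_le.2 ⟨by nlinarith, by nlinarith⟩)
    have hDsub := hD.abs_sub_le hDy hP.le hK1 hKξ hKy (δ := 2 * δ) (fun t => by
      rw [sub_sub_sub_cancel_left, abs_le]
      constructor <;> linarith)
    have hDκ : |D| ≤ Real.exp κ + Real.exp (-κ) := by
      have : |D| ≤ |D - Dy| + |Dy| := by simpa using abs_add_le (D - Dy) Dy
      linarith
    have hrate : 2 * κ / P = ε / 4 := by rw [hκ]; field_simp; norm_num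
    have h := HalfLine.IsSolution.abs_le (ε := ε / 4) (A := A) (B := A) hp_cont hq hA0.le
      (fun x hx => by
        obtain ⟨w, w', hw, hwx, hwx'⟩ :=
          HalfLine.exists_globalSolution (hcont ξ) (hbdd ξ) x 0 (-1)
        have hb := fun t ht => hD.backward_bound (fun t => by simp only [hp_periodic t]) hP hK1 hKξ
          hκ0 hDκ hw hwx hwx' (t := t) ht
        rw [hrate] at hb
        have hb0 := hb 0 hx
        rw [sub_zero] at hb0
        exact ⟨w, w', hw, hwx, hwx', fun t ht => (hb t ht.2).1, hb0.1, hb0.2⟩) hu hbc hx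
    refine h.trans ?_
    have hqx : A * ∫ t in (0 : ℝ)..x, |q t| ≤ A * C₁ + ε / 8 * x := by
      have := mul_le_mul_of_nonneg_left (hqC₁ x hx) hA0.le
      refine this.trans (le_of_eq ?_)
      field_simp
    calc A * Real.exp (ε / 4 * x) * Real.exp (2 * (A * ∫ t in (0 : ℝ)..x, |q t|))
        = A * Real.exp (ε / 4 * x + 2 * (A * ∫ t in (0 : ℝ)..x, |q t|)) := by
          rw [mul_assoc, ← Real.exp_add]
      _ ≤ A * Real.exp (2 * (A * C₁) + ε / 2 * x) :=
          mul_le_mul_of_nonneg_left (Real.exp_le_exp.2 (by linarith)) hA0.le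
      _ = A * Real.exp (2 * (A * C₁)) * Real.exp (ε / 2 * x) := by rw [Real.exp_add]; ring
      _ ≤ _ := mul_le_mul_of_nonneg_right (le_max_right _ _) (Real.exp_pos _).le
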